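/- Let $p$ be a prime, $F$ a totally real number field with ring of integers $\mathcal{O}_F$, $n\ge 1$, and let $E$ be a finite extension of $\mathbb{Q}_p$ with ring of integers $\mathcal{O}$. For a commutative ring $A$ put $R_A=\mathcal{O}_F\otimes_{\mathbb{Z}}A$. Let $G=\mathrm{Res}_{\mathcal{O}_F/\mathbb{Z}}\mathrm{GL}_{2n}$, so that $G(A)=\mathrm{GL}_{2n}(R_A)$, with diagonal torus $T$ and with unipotent radicals $N$, $N^-$ of the upper and lower triangular Borel subgroups; let $\mathfrak{n}_A$ be the Lie algebra of strictly upper triangular matrices over $R_A$, and let $\mathcal{U}(\mathfrak{n}_{A})$ be its enveloping algebra over $A$. Let $H=\mathrm{Res}_{\mathcal{O}_F/\mathbb{Z}}(\mathrm{GL}_n\times\mathrm{GL}_n)$, embedded in $G$ by $\iota(h_1,h_2)=\mathrm{diag}(h_1,h_2)$. Let $\mu=(\mu_\sigma)_{\sigma:F\hookrightarrow\bar E}$, $\mu_\sigma=(\mu_{\sigma,1}\ge\dots\ge\mu_{\sigma,2n})\in\mathbb{Z}^{2n}$, be a dominant weight of $T$ that is defined over $E$ (invariant under $\mathrm{Gal}(\bar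 E/E)$) and pure: there is $\mathsf{w}\in\mathbb{Z}$ with $\mu_{\sigma,i}+\mu_{\sigma,2n+1-i}=\mathsf{w}$ for all $\sigma,i$. Put $\mu^\vee_{\sigma,i}=-\mu_{\sigma,2n+1-i}$ and $$\mathrm{Crit}(\mu)=\{j\in\mathbb{Z}\mid \mu_{\sigma,n}\ge j\ge\mu_{\sigma,n+1}\ \text{for all }\sigma\}.$$ Let $V=V^\mu_E$ be the irreducible algebraic representation of $G$ over $E$ of highest weight $\mu$, let $v_0\in V$ be a lowest weight vector (non-zero, fixed by $N^-$, of weight $-\mu^\vee$), and put $V_{\mathcal{O}}=\mathcal{U}(\mathfrak{n}_{\mathcal{O}})\,v_0\subset V$. Let $$\xi=\begin{pmatrix}\mathbf{1}_n&w_n\\ \mathbf{0}_n&w_n\end{pmatrix},\qquad t_p=\iota(p\mathbf{1}_n,\mathbf{1}_n),$$ where $w_n$ is the antidiagonal permutation matrix, and for $\beta\in\mathbb{Z}_{\ge0}$ and $v\in V$ put $(\xi t_p^\beta)\bullet v=\mu^\vee(t_p^\beta)\,(\xi t_p^\beta)\cdot v$. For each $j\in\mathrm{Crit}(\mu)$ let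 $\kappa_j:V\to E$ be a non-zero $E$-linear functional that is $H$-equivariant for the action of $(h_1,h_2)\in H$ on the target by $\mathrm{N}_{F/\mathbb{Q}}(\det(h_1)^{j}\det(h_2)^{\mathsf{w}-j})$. Then: 1. for every $j\in\mathrm{Crit}(\mu)$ one has $\kappa_j(\xi v_0)\neq0$, and the normalized functional $\kappa_j^\circ=\kappa_j/\kappa_j(\xi v_0)$, which satisfies $\kappa_j^\circ(\xi v_0)=1$, takes values in $\mathcal{O}$ on $\xi V_{\mathcal{O}}$; 2. for every integer $\beta\ge0$ one has $(\xi t_p^\beta)\bullet V_{\mathcal{O}}\subseteq\xi V_{\mathcal{O}}$, and for all $v\in(\xi t_p^\beta)\bullet V_{\mathcal{O}}$ and all $j,j'\in\mathrm{Crit}(\mu)$ $$\kappa_j^\circ(v)\equiv\kappa_{j'}^\circ(v)\pmod{p^\beta\mathcal{O}}.$$ -/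

import Mathlib

open scoped TensorProduct NumberField

universe u v w

noncomputable section

/-! ### The groups `G = Res GL_{2n}`, `H = Res (GL_n × GL_n)` and their points

The index set of a `2n × 2n` matrix is `Fin n ⊕ Fin n` (so that `n × n` blocks can be written with
`Matrix.fromBlocks`), ordered through its position in `{0, …, 2n - 1}`. -/

/-- Block index of the rows and columns of a `2n × 2n` matrix. -/
abbrev Idx (n : ℕ) : Type := Fin n ⊕ Fin n

/-- Position of a block index among `0, …, 2n - 1`: the first block comes first. -/
abbrev pos {n : ℕ} : Idx n ≃ Fin (n + n) := finSumFinEquiv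

/-- `A ⊗ 𝓞_F`, the ring of `A`-points of `Res_{𝓞_F/ℤ} 𝔸¹`. -/
abbrev RO (F : Type v) [Field F] (A : Type u) [CommRing A] : Type (max u v) := A ⊗[ℤ] 𝓞 F

/-- Functoriality of `A ↦ A ⊗ 𝓞_F`. -/
def RO.map (F : Type v) [Field F] {A B : Type u} [CommRing A] [CommRing B] (f : A →+* B) :
    RO F A →+* RO F B :=
  (Algebra.TensorProduct.map f.toIntAlgHom (AlgHom.id ℤ (𝓞 F))).toRingHom

/-- `G(A) = GL_{2n}(A ⊗ 𝓞_F)`. -/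
abbrev GPts (F : Type v) [Field F] (n : ℕ) (A : Type u) [CommRing A] : Type (max u v) :=
  GL (Idx n) (RO F A)

/-- `ι : GL_n × GL_n → GL_{2n}`, `(h₁, h₂) ↦ diag(h₁, h₂)`. -/
def iota {n : ℕ} {R : Type*} [CommRing R] (h₁ h₂ : GL (Fin n) R) : GL (Idx n) R where
  val := Matrix.fromBlocks h₁.val 0 0 h₂.val
  inv := Matrix.fromBlocks h₁⁻¹.val 0 0 h₂⁻¹.val
  val_inv := by
    rw [Matrix.fromBlocks_multiply]
    simp [-Matrix.coe_units_inv, ← Matrix.fromBlocks_one]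
  inv_val := by
    rw [Matrix.fromBlocks_multiply]
    simp [-Matrix.coe_units_inv, ← Matrix.fromBlocks_one]

/-- The antidiagonal permutation matrix `w_n`. -/
def wMat (n : ℕ) (R : Type*) [CommRing R] : Matrix (Fin n) (Fin n) R :=
  Matrix.of fun i j => if i = Fin.rev j then 1 else 0

theorem wMat_mul_self (n : ℕ) (R : Type*) [CommRing R] : wMat n R * wMat n R = 1 := by
  ext i j
  simp [wMat, Matrix.mul_apply, Matrix.one_apply]

/-- `ξ = (1 w_n; 0 w_n)`. -/
def xi (n : ℕ) (R : Type*) [CommRing R] : GL (Idx n) R where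
  val := Matrix.fromBlocks 1 (wMat n R) 0 (wMat n R)
  inv := Matrix.fromBlocks 1 (-1) 0 (wMat n R)
  val_inv := by
    rw [Matrix.fromBlocks_multiply]
    simp [wMat_mul_self, ← Matrix.fromBlocks_one]
  inv_val := by
    rw [Matrix.fromBlocks_multiply]
    simp [wMat_mul_self, ← Matrix.fromBlocks_one]

/-- The diagonal torus. -/
def diagGL {n : ℕ} {R : Type*} [CommRing R] (t : Idx n → Rˣ) : GL (Idx n) R :=
  Units.map (Matrix.diagonalRingHom (Idx n) R).toMonoidHom (MulEquiv.piUnits.symm t)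

/-- Membership in the unipotent radical `N` of the upper triangular Borel subgroup. -/
def IsUpperUnipotent {n : ℕ} {R : Type*} [CommRing R] (g : GL (Idx n) R) : Prop :=
  ∀ a b : Idx n, pos b ≤ pos a → g.val a b = if a = b then 1 else 0

/-- Membership in the unipotent radical `N⁻` of the lower triangular Borel subgroup. -/
def IsLowerUnipotent {n : ℕ} {R : Type*} [CommRing R] (g : GL (Idx n) R) : Prop :=
  ∀ a b : Idx n, pos a ≤ pos b → g.val a b = if a = b then 1 else 0

/-! ### Weights -/

/-- Integral weights `(μ_σ)_σ`, `μ_σ ∈ ℤ^{2n}`, of the diagonal torus of `G`, with `σ` running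
through the embeddings of `F` into an algebraic closure of `E`. -/
abbrev Weight (F : Type v) [Field F] (E : Type u) [Field E] (n : ℕ) : Type (max u v) :=
  (F →+* AlgebraicClosure E) → Fin (n + n) → ℤ

section Weights

variable {F : Type v} [Field F] {E : Type u} [Field E] {n : ℕ}

/-- `μ_{σ,1} ≥ … ≥ μ_{σ,2n}`. -/
def IsDominant (μ : Weight F E n) : Prop := ∀ σ, Antitone (μ σ)

/-- `μ^∨ = -w_{2n}(μ)`, the highest weight of the contragredient of `V^μ`. -/
def dualWeight (μ : Weight F E n) : Weight F E n := fun σ i => - μ σ (Fin.rev i)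

/-- `μ` is pure of purity weight `w`: it is the highest weight of `V^{μ^∨} ⊗ (N_{F/ℚ} ∘ det)^w`. -/
def IsPure (μ : Weight F E n) (w : ℤ) : Prop := ∀ σ i, μ σ i = dualWeight μ σ i + w

/-- `μ` is defined over `E`, i.e. invariant under the absolute Galois group of `E`. -/
def IsDefinedOver (μ : Weight F E n) : Prop :=
  ∀ (τ : AlgebraicClosure E ≃ₐ[E] AlgebraicClosure E) (σ : F →+* AlgebraicClosure E),
    μ ((τ : AlgebraicClosure E →+* AlgebraicClosure E).comp σ) = μ σ

/-- `Crit(μ)`: the integers `j` with `μ_{σ,n} ≥ j ≥ μ_{σ,n+1}` for all `σ`. The `n`-th and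
`(n+1)`-st entries (counted from `1`) are those at `i` with `i + 1 = n` and `i = n` in
`Fin (n + n)`. -/
def Crit (μ : Weight F E n) : Set ℤ :=
  {j | ∀ σ, ∀ i : Fin (n + n), ((i : ℕ) + 1 = n → j ≤ μ σ i) ∧ ((i : ℕ) = n → μ σ i ≤ j)}

/-- The map `A ⊗ 𝓞_F → A` induced by an embedding `σ` of `F`, for an algebra `A` over the
algebraic closure of `E`. -/
def embPt (A : Type u) [CommRing A] [Algebra (AlgebraicClosure E) A]
    (σ : F →+* AlgebraicClosure E) : RO F A →+* A :=
  (Algebra.TensorProduct.productMap (AlgHom.id ℤ A)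
    (((algebraMap (AlgebraicClosure E) A).comp
      (σ.comp (algebraMap (𝓞 F) F))).toIntAlgHom)).toRingHom

/-- The value `∏_σ ∏_a σ(t_a)^{ν_{σ,a}}` of the weight `ν` at a point `t` of the diagonal torus. -/
def weightChar [NumberField F] [CharZero E] (ν : Weight F E n) (A : Type u) [CommRing A]
    [Algebra (AlgebraicClosure E) A] (t : Idx n → (RO F A)ˣ) : Aˣ :=
  ∏ σ : F →+* AlgebraicClosure E, ∏ a : Idx n,
    (Units.map (embPt A σ).toMonoidHom (t a)) ^ (ν σ (pos a))

end Weights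

/-! ### Algebraic representations of `G` over `E` -/

/-- An algebraic representation of `G` on the `E`-vector space `V`: a homomorphism of group functors
`G → GL_V` on commutative `E`-algebras. -/
structure AlgRep (F : Type v) [Field F] (n : ℕ) (E : Type u) [Field E]
    (V : Type w) [AddCommGroup V] [Module E V] where
  /-- the action of `G(A)` on `A ⊗ V` -/
  act : ∀ (A : Type u) [CommRing A] [Algebra E A], Representation A (GPts F n A) (A ⊗[E] V)
  /-- naturality in the algebra `A` -/
  natural : ∀ (A B : Type u) [CommRing A] [Algebra E A] [CommRing B] [Algebra E B]
    (f : A →ₐ[E] B) (g : GPts F n A) (x : A ⊗[E] V),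
    (f.toLinearMap.rTensor V) (act A g x) =
      act B (Matrix.GeneralLinearGroup.map (RO.map F (f : A →+* B)) g)
        (f.toLinearMap.rTensor V x)

/-- The matrix `ε X` over `E[ε] ⊗ 𝓞_F`, for `X ∈ 𝔤_E = M_{2n}(E ⊗ 𝓞_F)`. -/
def epsMul {F : Type v} [Field F] {n : ℕ} {E : Type u} [Field E]
    (X : Matrix (Idx n) (Idx n) (RO F E)) : Matrix (Idx n) (Idx n) (RO F (DualNumber E)) :=
  X.map fun x => (DualNumber.eps ⊗ₜ 1) * RO.map F (algebraMap E (DualNumber E)) x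

theorem epsMul_mul_self {F : Type v} [Field F] {n : ℕ} {E : Type u} [Field E]
    (X : Matrix (Idx n) (Idx n) (RO F E)) : epsMul X * epsMul X = 0 := by
  ext a b
  have h : (DualNumber.eps ⊗ₜ 1 : RO F (DualNumber E)) * (DualNumber.eps ⊗ₜ 1) = 0 := by
    rw [Algebra.TensorProduct.tmul_mul_tmul, DualNumber.eps_mul_eps, TensorProduct.zero_tmul]
  simp only [epsMul, Matrix.mul_apply, Matrix.map_apply, Matrix.zero_apply]
  refine Finset.sum_eq_zero fun c _ => ?_
  rw [mul_mul_mul_comm, h, zero_mul]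

/-- The point `1 + ε X` of `G(E[ε])` attached to `X ∈ 𝔤_E`. -/
def onePlusEps {F : Type v} [Field F] {n : ℕ} {E : Type u} [Field E]
    (X : Matrix (Idx n) (Idx n) (RO F E)) : GPts F n (DualNumber E) where
  val := 1 + epsMul X
  inv := 1 - epsMul X
  val_inv := by
    rw [add_mul, mul_sub, mul_sub, epsMul_mul_self]
    simp
  inv_val := by
    rw [sub_mul, mul_add, mul_add, epsMul_mul_self]
    simp

namespace AlgRep

variable {F : Type v} [Field F] {n : ℕ} {E : Type u} [Field E]
  {V : Type w} [AddCommGroup V] [Module E V] (ρ : AlgRep F n E V)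

/-- The action of `G(E)` on `V`. -/
def onPts (g : GPts F n E) : V →ₗ[E] V :=
  (TensorProduct.lid E V).toLinearMap ∘ₗ ρ.act E g ∘ₗ (TensorProduct.lid E V).symm.toLinearMap

/-- The differential `dρ : 𝔤_E → End V`: the coefficient of `ε` in
`ρ(1 + ε X) (1 ⊗ v) = 1 ⊗ v + ε ⊗ dρ(X) v`. -/
def lie (X : Matrix (Idx n) (Idx n) (RO F E)) : V →ₗ[E] V :=
  (TensorProduct.lid E V).toLinearMap ∘ₗ
    (TrivSqZeroExt.sndHom E E).rTensor V ∘ₗ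
      (ρ.act (DualNumber E) (onePlusEps X)).restrictScalars E ∘ₗ
        TensorProduct.mk E (DualNumber E) V 1

/-- `V` is an irreducible representation: it is non-zero and a subspace stable under `G` is
`0` or `V`. -/
def IsIrreducible : Prop :=
  Nontrivial V ∧ ∀ W : Submodule E V,
    (∀ (A : Type u) [CommRing A] [Algebra E A] (g : GPts F n A), ∀ x ∈ W,
      ρ.act A g (1 ⊗ₜ x) ∈ W.baseChange A) → W = ⊥ ∨ W = ⊤

/-- `κ ∈ Hom_H(V, V^{(j₁,j₂)})`, where `V^{(j₁,j₂)}` is the line on which `(h₁, h₂) ∈ H` acts by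
`N_{F/ℚ}(det(h₁)^{j₁} det(h₂)^{j₂})`. -/
def IsHEquivariant (j₁ j₂ : ℤ) (κ : V →ₗ[E] E) : Prop :=
  ∀ (A : Type u) [CommRing A] [Algebra E A] (h₁ h₂ : GL (Fin n) (RO F A)) (x : V),
    κ.baseChange A (ρ.act A (iota h₁ h₂) (1 ⊗ₜ x)) =
      (Units.map (Algebra.norm A : RO F A →* A)
        (Matrix.GeneralLinearGroup.det h₁ ^ j₁ * Matrix.GeneralLinearGroup.det h₂ ^ j₂) : A) ⊗ₜ
          κ x

variable [NumberField F] [CharZero E]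

/-- The torus `T` acts on `x` through the weight `ν`. -/
def HasWeight (ν : Weight F E n) (x : V) : Prop :=
  ∀ (A : Type u) [CommRing A] [Algebra E A] [Algebra (AlgebraicClosure E) A]
    [IsScalarTower E (AlgebraicClosure E) A] (t : Idx n → (RO F A)ˣ),
    ρ.act A (diagGL t) (1 ⊗ₜ x) = (weightChar ν A t : A) ⊗ₜ x

/-- `x` is a highest weight vector of weight `μ`: non-zero, fixed by `N`, of weight `μ`. -/
def IsHighestWeightVector (μ : Weight F E n) (x : V) : Prop :=
  x ≠ 0 ∧ ρ.HasWeight μ x ∧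
    ∀ (A : Type u) [CommRing A] [Algebra E A] (g : GPts F n A), IsUpperUnipotent g →
      ρ.act A g (1 ⊗ₜ x) = 1 ⊗ₜ x

/-- `x` is a lowest weight vector of `V^μ`: non-zero, fixed by `N⁻`, of weight
`-μ^∨ = w_{2n}(μ)`. -/
def IsLowestWeightVector (μ : Weight F E n) (x : V) : Prop :=
  x ≠ 0 ∧ ρ.HasWeight (-dualWeight μ) x ∧
    ∀ (A : Type u) [CommRing A] [Algebra E A] (g : GPts F n A), IsLowerUnipotent g →
      ρ.act A g (1 ⊗ₜ x) = 1 ⊗ₜ x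

/-- `V` is (a model of) `V^μ_E`, the irreducible algebraic representation of highest weight `μ`. -/
def IsModel (μ : Weight F E n) : Prop :=
  ρ.IsIrreducible ∧ ∃ x : V, ρ.IsHighestWeightVector μ x

end AlgRep

/-! ### The lattice, the twisted action and the normalized functionals -/

/-- The ring of integers of a finite extension `E` of `ℚ_p`: the integral closure of `ℤ_p`. -/
def ringInt (p : ℕ) [Fact p.Prime] (E : Type u) [Field E] [Algebra ℚ_[p] E] : Subring E :=
  letI : Algebra ℤ_[p] E := ((algebraMap ℚ_[p] E).comp (algebraMap ℤ_[p] ℚ_[p])).toAlgebra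
  (integralClosure ℤ_[p] E).toSubring

/-- `𝔫_A`: the strictly upper triangular matrices in `𝔤_A = M_{2n}(A ⊗ 𝓞_F)`. -/
def nilUpper (F : Type v) [Field F] (n : ℕ) (A : Type u) [CommRing A] :
    Set (Matrix (Idx n) (Idx n) (RO F A)) :=
  {X | ∀ a b : Idx n, pos b ≤ pos a → X a b = 0}

namespace AlgRep

variable {F : Type v} [Field F] {n : ℕ} {E : Type u} [Field E]
  {V : Type w} [AddCommGroup V] [Module E V] (ρ : AlgRep F n E V)

/-- The image of the enveloping algebra `𝒰(𝔫_O)` in `End V`, i.e. the `O`-subalgebra generated by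
the operators `dρ(X)`, `X ∈ 𝔫_O`. -/
def envN (O : Subring E) : Subalgebra O (Module.End E V) :=
  Algebra.adjoin O {T | ∃ X ∈ nilUpper F n O, T = ρ.lie (X.map (RO.map F O.subtype))}

/-- The lattice `V_O = 𝒰(𝔫_O) v₀`. -/
def lattice (O : Subring E) (v₀ : V) : Set V := {x | ∃ m ∈ ρ.envN O, x = m v₀}

/-- `t_p = ι(p 1_n, 1_n) ∈ G(E)`. -/
def tp (F : Type v) [Field F] (n : ℕ) (E : Type u) [Field E] [CharZero E]
    (p : ℕ) [hp : Fact p.Prime] : GPts F n E :=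
  iota (Units.map (Matrix.scalar (Fin n)).toMonoidHom
    (Units.map (algebraMap E (RO F E)).toMonoidHom
      (Units.mk0 (p : E) (Nat.cast_ne_zero.mpr hp.out.ne_zero)))) 1

/-- `μ^∨(t_p) = ∏_σ ∏_{i ≤ n} p^{μ^∨_{σ,i}}`. -/
def dualAtTp [NumberField F] [CharZero E] (p : ℕ) (μ : Weight F E n) : E :=
  ∏ σ : F →+* AlgebraicClosure E, ∏ i : Fin n, (p : E) ^ dualWeight μ σ (pos (Sum.inl i))

/-- `(ξ t_p^β) • x = μ^∨(t_p^β) (ξ t_p^β) · x`. -/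
def bullet [NumberField F] [CharZero E] (p : ℕ) [Fact p.Prime] (μ : Weight F E n) (β : ℕ)
    (x : V) : V :=
  dualAtTp p μ ^ β • ρ.onPts (xi n (RO F E) * tp F n E p ^ β) x

/-- The functional `κ°` on `V` defined by `κ(x) = κ°(x) κ(ξ v₀)`. -/
def normalized (κ : V →ₗ[E] E) (v₀ : V) (x : V) : E :=
  κ x / κ (ρ.onPts (xi n (RO F E)) v₀)

end AlgRep

end

/-! Integrality and congruence come from one Lie algebra argument. Put `ψ_j(x) = κ_j°(ξ x)`.
Differentiating the `H`-equivariance of `κ_j` shows that `ψ_j(dρ(Y) x)` is a scalar multiple of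
`ψ_j(x)` whenever `ξ Y ξ⁻¹ = diag(M, N)`. The scalar is `Tr(j tr M + (w - j) tr N)`, with `Tr` the
trace of `E ⊗ 𝓞_F` over `E`. If `M = N + p^β r`, it equals `w Tr(tr N) + j p^β Tr(tr r)`, which is
integral and modulo `p^β` does not depend on `j`. Hence `dρ(Y)` preserves the `O`-module of vectors
on which `ψ_j`, `ψ_{j'}` are integral and congruent modulo `p^β`. This module contains `v₀`, where
both functionals equal `1`.

Every integral matrix that is block lower triangular modulo `p^β` is such a `Y` plus a lower
triangular `Z` (`exists_block_decomposition`). The operator `dρ(Z)` has `v₀` as an eigenvector with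
integral eigenvalue and normalizes the set of all these operators, so a filtration argument
(`adjoin_apply_mem`) shows that the algebra they generate maps `v₀` into the module. Taking `β = 0`
covers `𝒰(𝔫_O)` and gives integrality. In general, conjugation by `t_p^β` multiplies the upper right
block of `𝔫_O` by `p^β`, and the twist by `μ^∨(t_p^β)` cancels the eigenvalue of `t_p^β` on `v₀`. So
`(ξ t_p^β) • V_O` lies in `ξ V_O` and satisfies the congruence.

The non-vanishing of `κ_j(ξ v₀)` is an open orbit argument: `H ξ T N⁻` contains a formal
neighbourhood of `ξ` (`exists_xi_factorization`). If `κ_j(ξ v₀) = 0`, then the function `g ↦ κ_j(ξ g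
v₀)` vanishes on the formal neighbourhood of `1`, hence on all of `G`. The vectors `x` with `κ_j(g
x) = 0` for all `g` then form a non-zero `G`-stable subspace, which must be `V`, contradicting `κ_j
≠ 0`. -/

noncomputable section

/-! ### Base change for `A ⊗ 𝓞_F` and infinitesimal points `1 + e X` -/

section Maps

variable {F : Type v} [Field F]

@[simp]
theorem RO.map_tmul {A B : Type u} [CommRing A] [CommRing B] (f : A →+* B) (a : A) (x : 𝓞 F) :
    RO.map F f (a ⊗ₜ x) = f a ⊗ₜ x := by
  simp [RO.map]

theorem RO.map_map {A B C : Type u} [CommRing A] [CommRing B] [CommRing C] (f : A →+* B)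
    (g : B →+* C) (x : RO F A) : RO.map F g (RO.map F f x) = RO.map F (g.comp f) x := by
  induction x using TensorProduct.induction_on with
  | zero => simp
  | add x y hx hy => simp [hx, hy]
  | tmul a x => simp

variable {n : ℕ}

/-- The invertible matrix `1 + e X`, for a scalar `e` of square zero. -/
def sqZeroUnit {m : Type*} [Fintype m] [DecidableEq m] {R : Type*} [CommRing R] (e : R)
    (he : e * e = 0) (X : Matrix m m R) : GL m R where
  val := 1 + e • X
  inv := 1 - e • X
  val_inv := by
    rw [add_mul, mul_sub, mul_sub, smul_mul_smul_comm, he]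
    simp
  inv_val := by
    rw [sub_mul, mul_add, mul_add, smul_mul_smul_comm, he]
    simp

section SqZero

variable {m : Type*} [Fintype m] [DecidableEq m] {R S : Type*} [CommRing R] [CommRing S]

theorem map_sqZeroUnit (f : R →+* S) (e : R) (he : e * e = 0) (X : Matrix m m R) :
    Matrix.GeneralLinearGroup.map f (sqZeroUnit e he X) =
      sqZeroUnit (f e) (by rw [← _root_.map_mul, he, _root_.map_zero]) (X.map f) := by
  ext a b
  simp [sqZeroUnit, Matrix.one_apply, apply_ite]

theorem sqZeroUnit_add (e : R) (he : e * e = 0) (X Y : Matrix m m R) :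
    sqZeroUnit e he (X + Y) = sqZeroUnit e he X * sqZeroUnit e he Y := by
  apply Units.ext
  simp only [sqZeroUnit, Units.val_mul, add_mul, mul_add, smul_mul_smul_comm, he, smul_add]
  simp only [mul_one, one_mul, zero_smul, add_zero]
  abel

theorem mul_sqZeroUnit (e : R) (he : e * e = 0) (g : GL m R) (X Y : Matrix m m R)
    (h : g.val * X = Y * g.val) : g * sqZeroUnit e he X = sqZeroUnit e he Y * g := by
  apply Units.ext
  simp only [sqZeroUnit, Units.val_mul, add_mul, mul_add, Matrix.mul_smul, Matrix.smul_mul, h]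
  simp

/-- All terms containing `e₁²` or `e₂²` vanish, so the group commutator retains only the bracket,
with coefficient `e₁ e₂`. -/
theorem sqZeroUnit_commutator (e₁ e₂ : R) (he₁ : e₁ * e₁ = 0) (he₂ : e₂ * e₂ = 0)
    (he₃ : (e₁ * e₂) * (e₁ * e₂) = 0) (X Y : Matrix m m R) :
    sqZeroUnit e₁ he₁ X * sqZeroUnit e₂ he₂ Y =
      sqZeroUnit (e₁ * e₂) he₃ (X * Y - Y * X) *
        (sqZeroUnit e₂ he₂ Y * sqZeroUnit e₁ he₁ X) := by
  have h2 : (e₁ * e₂) * e₁ = 0 := by rw [mul_right_comm, he₁, zero_mul]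
  have h3 : (e₁ * e₂) * e₂ = 0 := by rw [mul_assoc, he₂, mul_zero]
  have h4 : (e₁ * e₂) * (e₂ * e₁) = 0 := by rw [mul_comm e₂, he₃]
  apply Units.ext
  simp only [Units.val_mul, sqZeroUnit]
  simp only [add_mul, mul_add, mul_one, one_mul, smul_mul_smul_comm, h2, h3, h4, zero_smul,
    smul_sub, sub_mul, sub_zero, add_zero]
  rw [mul_comm e₂ e₁]
  abel

end SqZero

theorem tmul_sq_zero {A : Type u} [CommRing A] {e : A} (he : e * e = 0) :
    (e ⊗ₜ 1 : RO F A) * (e ⊗ₜ 1) = 0 := by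
  rw [Algebra.TensorProduct.tmul_mul_tmul, he, TensorProduct.zero_tmul]

/-- The point `1 + e X` of `G(A)`, for `e ∈ A` of square zero. -/
def onePlus {A : Type u} [CommRing A] (e : A) (he : e * e = 0)
    (X : Matrix (Idx n) (Idx n) (RO F A)) : GPts F n A :=
  sqZeroUnit (e ⊗ₜ 1 : RO F A) (tmul_sq_zero he) X

theorem map_onePlus {A B : Type u} [CommRing A] [CommRing B] (f : A →+* B) (e : A) (he : e * e = 0)
    (X : Matrix (Idx n) (Idx n) (RO F A)) :
    Matrix.GeneralLinearGroup.map (RO.map F f) (onePlus e he X) =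
      onePlus (f e) (by rw [← _root_.map_mul, he, _root_.map_zero]) (X.map (RO.map F f)) := by
  rw [onePlus, map_sqZeroUnit]
  simp [onePlus]

theorem onePlusEps_eq {E : Type u} [Field E] (X : Matrix (Idx n) (Idx n) (RO F E)) :
    onePlusEps X = onePlus DualNumber.eps DualNumber.eps_mul_eps
      (X.map (RO.map F (algebraMap E (DualNumber E)))) := by
  ext a b
  simp [onePlus, onePlusEps, sqZeroUnit, epsMul]

/-- The homomorphism `E[ε] → A` with `ε ↦ e`. -/
def dualEval {E A : Type u} [Field E] [CommRing A] [Algebra E A] (e : A) (he : e * e = 0) :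
    DualNumber E →ₐ[E] A :=
  DualNumber.lift ⟨(Algebra.ofId E A, e), he, fun _ => Commute.all _ _⟩

theorem dualEval_eps {E A : Type u} [Field E] [CommRing A] [Algebra E A] (e : A)
    (he : e * e = 0) : dualEval (E := E) e he DualNumber.eps = e := by
  simp [dualEval]

theorem map_dualEval_onePlusEps {E A : Type u} [Field E] [CommRing A] [Algebra E A] (e : A)
    (he : e * e = 0) (X : Matrix (Idx n) (Idx n) (RO F E)) :
    Matrix.GeneralLinearGroup.map (RO.map F (dualEval (E := E) e he : DualNumber E →+* A))
      (onePlusEps X) = onePlus e he (X.map (RO.map F (algebraMap E A))) := by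
  rw [onePlusEps_eq, map_onePlus]
  ext a b
  simp [onePlus, sqZeroUnit, RO.map_map, dualEval_eps]

end Maps

/-! ### The differential of an algebraic representation -/

namespace AlgRep

/-- The contraction `A ⊗ V → V` along a linear form on `A`. -/
def contract {E : Type u} [Field E] {A : Type*} [AddCommGroup A] [Module E A] (V : Type w)
    [AddCommGroup V] [Module E V] (l : A →ₗ[E] E) : A ⊗[E] V →ₗ[E] V :=
  (TensorProduct.lid E V).toLinearMap ∘ₗ l.rTensor V

@[simp]
theorem contract_tmul {E : Type u} [Field E] {A : Type*} [AddCommGroup A] [Module E A] {V : Type w}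
    [AddCommGroup V] [Module E V] (l : A →ₗ[E] E) (a : A) (x : V) :
    contract V l (a ⊗ₜ x) = l a • x := by
  simp [contract]

variable {F : Type v} [Field F] {n : ℕ} {E : Type u} [Field E]
  {V : Type w} [AddCommGroup V] [Module E V] (ρ : AlgRep F n E V)

theorem act_map_one_tmul {A : Type u} [CommRing A] [Algebra E A] (g : GPts F n E) (x : V) :
    ρ.act A (Matrix.GeneralLinearGroup.map (RO.map F (algebraMap E A)) g) (1 ⊗ₜ x) =
      1 ⊗ₜ ρ.onPts g x := by
  have h := ρ.natural E A (Algebra.ofId E A) g (1 ⊗ₜ x)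
  simp only [LinearMap.rTensor_tmul, AlgHom.toLinearMap_apply, _root_.map_one] at h
  have h2 : ρ.act E g (1 ⊗ₜ x) = 1 ⊗ₜ ρ.onPts g x := by
    apply (TensorProduct.lid E V).injective
    simp [onPts]
  rw [h2] at h
  simpa using h.symm

theorem dual_tensor_eq (y : DualNumber E ⊗[E] V) :
    y = 1 ⊗ₜ contract V (TrivSqZeroExt.fstHom E E E).toLinearMap y +
      DualNumber.eps ⊗ₜ contract V (TrivSqZeroExt.sndHom E E) y := by
  induction y with
  | zero => simp
  | add x y hx hy =>
    simp only [_root_.map_add, TensorProduct.tmul_add]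
    nth_rw 1 [hx, hy]
    abel
  | tmul a x =>
    simp only [contract_tmul, ← TensorProduct.smul_tmul, ← TensorProduct.add_tmul]
    congr 1
    ext <;> simp

theorem act_onePlusEps (X : Matrix (Idx n) (Idx n) (RO F E)) (x : V) :
    ρ.act (DualNumber E) (onePlusEps X) (1 ⊗ₜ x) = 1 ⊗ₜ x + DualNumber.eps ⊗ₜ ρ.lie X x := by
  rw [dual_tensor_eq (ρ.act (DualNumber E) (onePlusEps X) (1 ⊗ₜ x))]
  congr 2
  -- The specialization `ε ↦ 0` sends `1 + ε X` to `1`, so by naturality the constant term is `x`.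
  have h := ρ.natural (DualNumber E) E (TrivSqZeroExt.fstHom E E E) (onePlusEps X) (1 ⊗ₜ x)
  have h1 : Matrix.GeneralLinearGroup.map
      (RO.map F ((TrivSqZeroExt.fstHom E E E : DualNumber E →ₐ[E] E) : DualNumber E →+* E))
      (onePlusEps X) = 1 := by
    rw [onePlusEps_eq, map_onePlus]
    ext a b
    simp [onePlus, sqZeroUnit, DualNumber.fst_eps]
  rw [h1] at h
  simp only [_root_.map_one, Module.End.one_apply] at h
  unfold contract
  rw [LinearMap.comp_apply, h]
  simp

/-- The defining property of the differential, over any algebra with an element of square zero. -/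
theorem act_onePlus {A : Type u} [CommRing A] [Algebra E A] (e : A) (he : e * e = 0)
    (X : Matrix (Idx n) (Idx n) (RO F E)) (x : V) :
    ρ.act A (onePlus e he (X.map (RO.map F (algebraMap E A)))) (1 ⊗ₜ x) =
      1 ⊗ₜ x + e ⊗ₜ ρ.lie X x := by
  have h := ρ.natural (DualNumber E) A (dualEval e he) (onePlusEps X) (1 ⊗ₜ x)
  rw [map_dualEval_onePlusEps, act_onePlusEps] at h
  simpa [dualEval_eps] using h.symm

theorem act_tmul {A : Type u} [CommRing A] [Algebra E A] (g : GPts F n A) (a : A) (x : V) :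
    ρ.act A g (a ⊗ₜ x) = a • ρ.act A g (1 ⊗ₜ x) := by
  rw [← _root_.map_smul, TensorProduct.smul_tmul', smul_eq_mul, mul_one]

theorem eq_of_eps_tmul {x y : V} (h : (DualNumber.eps : DualNumber E) ⊗ₜ[E] x =
    (DualNumber.eps : DualNumber E) ⊗ₜ[E] y) : x = y := by
  simpa using congrArg (contract V (TrivSqZeroExt.sndHom E E)) h

theorem lie_add (X Y : Matrix (Idx n) (Idx n) (RO F E)) :
    ρ.lie (X + Y) = ρ.lie X + ρ.lie Y := by
  ext x
  apply eq_of_eps_tmul (E := E)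
  have h : onePlusEps (X + Y) = onePlusEps X * onePlusEps Y := by
    rw [onePlusEps_eq, onePlusEps_eq, onePlusEps_eq, Matrix.map_add _ (by simp)]
    exact sqZeroUnit_add _ _ _ _
  have h1 := ρ.act_onePlusEps (X + Y) x
  rw [h, _root_.map_mul, Module.End.mul_apply, act_onePlusEps, _root_.map_add, act_onePlusEps,
    act_tmul, act_onePlusEps] at h1
  simp only [smul_add, TensorProduct.smul_tmul', smul_eq_mul, mul_one, DualNumber.eps_mul_eps,
    TensorProduct.zero_tmul, add_zero, add_assoc] at h1
  rw [LinearMap.add_apply, TensorProduct.tmul_add]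
  exact (add_left_cancel h1).symm

theorem onPts_mul (g h : GPts F n E) (x : V) : ρ.onPts (g * h) x = ρ.onPts g (ρ.onPts h x) := by
  simp [onPts]

theorem onPts_one (x : V) : ρ.onPts 1 x = x := by
  simp [onPts]

/-- Compare the coefficients of `ε` in `g (1 + ε X) = (1 + ε Y) g`. -/
theorem onPts_lie (g : GPts F n E) (X Y : Matrix (Idx n) (Idx n) (RO F E))
    (h : g.val * X = Y * g.val) (x : V) :
    ρ.onPts g (ρ.lie X x) = ρ.lie Y (ρ.onPts g x) := by
  apply eq_of_eps_tmul (E := E)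
  set g' := Matrix.GeneralLinearGroup.map (RO.map F (algebraMap E (DualNumber E))) g with hg'
  have h1 : g' * onePlusEps X = onePlusEps Y * g' := by
    rw [onePlusEps_eq, onePlusEps_eq]
    refine mul_sqZeroUnit _ _ g' _ _ ?_
    have h2 := congrArg (fun M => M.map (RO.map F (algebraMap E (DualNumber E)))) h
    simp only [Matrix.map_mul] at h2
    exact h2
  have h2 := congrArg (fun k => ρ.act _ k (1 ⊗ₜ x)) h1
  simp only [_root_.map_mul, Module.End.mul_apply, act_onePlusEps, _root_.map_add, hg',
    act_map_one_tmul] at h2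
  have h3 := add_left_cancel h2
  rw [act_tmul, act_map_one_tmul] at h3
  simpa [TensorProduct.smul_tmul'] using h3

theorem tmul_lie_commutator {A : Type u} [CommRing A] [Algebra E A] (e₁ e₂ : A)
    (he₁ : e₁ * e₁ = 0) (he₂ : e₂ * e₂ = 0) (X Y : Matrix (Idx n) (Idx n) (RO F E)) (x : V) :
    (e₁ * e₂) ⊗ₜ[E] ρ.lie X (ρ.lie Y x) =
      (e₁ * e₂) ⊗ₜ[E] (ρ.lie Y (ρ.lie X x) + ρ.lie (X * Y - Y * X) x) := by
  have he₃ : (e₁ * e₂) * (e₁ * e₂) = 0 := by rw [mul_mul_mul_comm, he₁, zero_mul]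
  have h2 : e₁ * (e₁ * e₂) = 0 := by rw [← mul_assoc, he₁, zero_mul]
  have h3 : e₂ * (e₁ * e₂) = 0 := by rw [mul_left_comm, he₂, mul_zero]
  let φ : RO F E →+* RO F A := RO.map F (algebraMap E A)
  have hgp : onePlus e₁ he₁ (X.map φ) * onePlus e₂ he₂ (Y.map φ) =
      onePlus (e₁ * e₂) he₃ ((X * Y - Y * X).map φ) *
        (onePlus e₂ he₂ (Y.map φ) * onePlus e₁ he₁ (X.map φ)) := by
    rw [Matrix.map_sub _ (by simp), Matrix.map_mul, Matrix.map_mul]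
    have h5 : (e₁ ⊗ₜ 1 : RO F A) * (e₂ ⊗ₜ 1) = (e₁ * e₂) ⊗ₜ 1 := by simp
    have h6 := sqZeroUnit_commutator _ _ (tmul_sq_zero (F := F) he₁) (tmul_sq_zero he₂)
      (by rw [h5]; exact tmul_sq_zero he₃) (X.map φ) (Y.map φ)
    simp only [h5] at h6
    exact h6
  have hact : ∀ (e : A) (he : e * e = 0) (Z : Matrix (Idx n) (Idx n) (RO F E)) (a : A) (y : V),
      ρ.act A (onePlus e he (Z.map φ)) (a ⊗ₜ y) = a ⊗ₜ y + (a * e) ⊗ₜ ρ.lie Z y := by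
    intro e he Z a y
    rw [act_tmul, act_onePlus, smul_add, TensorProduct.smul_tmul', TensorProduct.smul_tmul',
      smul_eq_mul, smul_eq_mul, mul_one]
  have h5 := congrArg (fun k => ρ.act A k (1 ⊗ₜ x)) hgp
  simp only [_root_.map_mul, Module.End.mul_apply, hact, _root_.map_add, one_mul, mul_comm e₂ e₁,
    he₃, h2, h3, TensorProduct.zero_tmul, add_zero] at h5
  rw [TensorProduct.tmul_add]
  linear_combination (norm := abel) h5

theorem lie_commutator (X Y : Matrix (Idx n) (Idx n) (RO F E)) (x : V) :
    ρ.lie X (ρ.lie Y x) = ρ.lie Y (ρ.lie X x) + ρ.lie (X * Y - Y * X) x := by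
  -- In the iterated dual numbers `e₁` is the inner and `e₂` the outer `ε`; taking `snd` twice reads
  -- off the coefficient of `e₁ e₂`.
  have h := ρ.tmul_lie_commutator (A := DualNumber (DualNumber E))
    (TrivSqZeroExt.inl DualNumber.eps) DualNumber.eps
    (by rw [← TrivSqZeroExt.inl_mul, DualNumber.eps_mul_eps, TrivSqZeroExt.inl_zero])
    DualNumber.eps_mul_eps X Y x
  simpa using congrArg (contract V (TrivSqZeroExt.sndHom E E ∘ₗ
    (TrivSqZeroExt.sndHom (DualNumber E) (DualNumber E)).restrictScalars E)) h

end AlgRep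

/-! ### Norm and trace of `A ⊗ 𝓞_F` over `A`, and the derivative of the characters of `H` -/

section NormTrace

variable (F : Type v) [Field F] [NumberField F]

/-- The basis of `A ⊗ 𝓞_F` over `A` coming from a basis of `𝓞_F` over `ℤ`. -/
def roBasis (A : Type u) [CommRing A] :
    Module.Basis (Fin (Module.finrank ℤ (𝓞 F))) A (RO F A) :=
  Algebra.TensorProduct.basis A (Module.finBasis ℤ (𝓞 F))

variable {F} {A B : Type u} [CommRing A] [CommRing B] (f : A →+* B)

theorem roBasis_repr_map (x : RO F A) (i : Fin (Module.finrank ℤ (𝓞 F))) :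
    (roBasis F B).repr (RO.map F f x) i = f ((roBasis F A).repr x i) := by
  induction x using TensorProduct.induction_on with
  | zero => simp
  | add x y hx hy => simp [hx, hy]
  | tmul a x => simp [roBasis, Algebra.TensorProduct.basis_repr_tmul]

theorem RO.map_roBasis (i : Fin (Module.finrank ℤ (𝓞 F))) :
    RO.map F f (roBasis F A i) = roBasis F B i := by
  simp [roBasis]

theorem leftMulMatrix_map (x : RO F A) :
    Algebra.leftMulMatrix (roBasis F B) (RO.map F f x) =
      (Algebra.leftMulMatrix (roBasis F A) x).map f := by
  ext i j
  rw [Matrix.map_apply, Algebra.leftMulMatrix_eq_repr_mul, Algebra.leftMulMatrix_eq_repr_mul,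
    ← roBasis_repr_map, map_mul (RO.map F f), RO.map_roBasis]

theorem RO.norm_map (x : RO F A) : Algebra.norm B (RO.map F f x) = f (Algebra.norm A x) := by
  rw [Algebra.norm_eq_matrix_det (roBasis F B), Algebra.norm_eq_matrix_det (roBasis F A),
    leftMulMatrix_map, RingHom.map_det]
  rfl

theorem RO.trace_map (x : RO F A) : Algebra.trace B (RO F B) (RO.map F f x) =
    f (Algebra.trace A (RO F A) x) := by
  rw [Algebra.trace_eq_matrix_trace (roBasis F B), Algebra.trace_eq_matrix_trace (roBasis F A),
    leftMulMatrix_map, Matrix.trace, Matrix.trace, map_sum]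
  rfl

/-- The norm is the determinant of multiplication by `x`; when it is a unit, multiplication is
bijective and hits `1`. -/
theorem isUnit_of_isUnit_norm (x : RO F A) (h : IsUnit (Algebra.norm A x)) : IsUnit x := by
  have := Module.Free.of_basis (roBasis F A)
  have := Module.Finite.of_basis (roBasis F A)
  rw [Algebra.norm_apply, ← LinearMap.isUnit_iff_isUnit_det, Module.End.isUnit_iff] at h
  obtain ⟨y, hy⟩ := h.2 1
  exact .of_mul_eq_one y hy

/-- The homomorphism `a ↦ 1 + e a`, for `e` of square zero. -/
def sqZeroHom {R : Type*} [CommRing R] (e : R) (he : e * e = 0) : Multiplicative R →* Rˣ where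
  toFun a :=
    { val := 1 + e * a.toAdd
      inv := 1 - e * a.toAdd
      val_inv := by linear_combination (- a.toAdd ^ 2) * he
      inv_val := by linear_combination (- a.toAdd ^ 2) * he }
  map_one' := by ext; simp
  map_mul' a b := by
    ext
    simp only [toAdd_mul, Units.val_mul]
    linear_combination (- a.toAdd * b.toAdd) * he

theorem sqZeroHom_val {R : Type*} [CommRing R] (e : R) (he : e * e = 0) (a : R) :
    (sqZeroHom e he (.ofAdd a)).val = 1 + e * a := rfl

theorem sqZeroHom_zpow {R : Type*} [CommRing R] (e : R) (he : e * e = 0) (a : R) (k : ℤ) :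
    sqZeroHom e he (.ofAdd a) ^ k = sqZeroHom e he (.ofAdd (k • a)) := by
  rw [ofAdd_zsmul, map_zpow]

theorem map_sqZeroHom {R S : Type*} [CommRing R] [CommRing S] (f : R →+* S) (e : R)
    (he : e * e = 0) (a : R) : Units.map f.toMonoidHom (sqZeroHom e he (.ofAdd a)) =
      sqZeroHom (f e) (by rw [← _root_.map_mul, he, _root_.map_zero]) (.ofAdd (f a)) := by
  ext
  simp [sqZeroHom_val]

theorem det_sqZeroUnit {m : Type*} [Fintype m] [DecidableEq m] {R : Type*} [CommRing R]
    (e : R) (he : e * e = 0) (X : Matrix m m R) :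
    Matrix.GeneralLinearGroup.det (sqZeroUnit e he X) = sqZeroHom e he (.ofAdd X.trace) := by
  ext
  rw [sqZeroHom_val]
  change (1 + e • X).det = _
  rw [Matrix.det_one_add_smul, pow_two, he]
  ring

theorem norm_sqZeroHom (e : A) (he : e * e = 0) (x : RO F A) :
    Units.map (Algebra.norm A : RO F A →* A) (sqZeroHom (e ⊗ₜ 1) (tmul_sq_zero he) (.ofAdd x)) =
      sqZeroHom e he (.ofAdd (Algebra.trace A (RO F A) x)) := by
  ext
  rw [Units.coe_map, sqZeroHom_val, sqZeroHom_val]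
  have h : (e ⊗ₜ 1 : RO F A) = algebraMap A (RO F A) e := rfl
  rw [h, Algebra.norm_eq_matrix_det (roBasis F A), _root_.map_add,
    _root_.map_one, _root_.map_mul,
    AlgHom.commutes, ← Algebra.smul_def, Matrix.det_one_add_smul, pow_two, he,
    Algebra.trace_eq_matrix_trace (roBasis F A)]
  ring

end NormTrace

namespace AlgRep

variable {F : Type v} [Field F] [NumberField F] {n : ℕ} {E : Type u} [Field E]
  {V : Type w} [AddCommGroup V] [Module E V] (ρ : AlgRep F n E V)

theorem iota_sqZeroUnit {R : Type*} [CommRing R] (e : R) (he : e * e = 0)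
    (A D : Matrix (Fin n) (Fin n) R) :
    iota (sqZeroUnit e he A) (sqZeroUnit e he D) =
      sqZeroUnit e he (Matrix.fromBlocks A 0 0 D) := by
  apply Units.ext
  simp [iota, sqZeroUnit, Matrix.fromBlocks_smul, ← Matrix.fromBlocks_one, Matrix.fromBlocks_add]

theorem RO.trace_trace_map {A B : Type u} [CommRing A] [CommRing B] (f : A →+* B)
    (M : Matrix (Fin n) (Fin n) (RO F A)) :
    Algebra.trace B (RO F B) (M.map (RO.map F f)).trace =
      f (Algebra.trace A (RO F A) M.trace) := by
  rw [← RO.trace_map]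
  congr 1
  simp [Matrix.trace]

theorem IsHEquivariant.apply_act_onePlus {j₁ j₂ : ℤ} {κ : V →ₗ[E] E}
    (hκ : ρ.IsHEquivariant j₁ j₂ κ) (M N : Matrix (Fin n) (Fin n) (RO F E)) (x : V)
    {A : Type u} [CommRing A] [Algebra E A] (e : A) (he : e * e = 0) :
    κ.baseChange A (1 ⊗ₜ x + e ⊗ₜ ρ.lie (Matrix.fromBlocks M 0 0 N) x) =
      (1 + e * algebraMap E A (j₁ * Algebra.trace E (RO F E) M.trace +
        j₂ * Algebra.trace E (RO F E) N.trace)) ⊗ₜ κ x := by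
  set φ := RO.map F (algebraMap E A) with hφ
  have h := hκ A (sqZeroUnit _ (tmul_sq_zero he) (M.map φ))
    (sqZeroUnit _ (tmul_sq_zero he) (N.map φ)) x
  rw [iota_sqZeroUnit, det_sqZeroUnit, det_sqZeroUnit, sqZeroHom_zpow, sqZeroHom_zpow,
    ← _root_.map_mul, ← ofAdd_add, norm_sqZeroHom e he, sqZeroHom_val,
    _root_.map_add (Algebra.trace _ _), map_zsmul, map_zsmul, hφ, RO.trace_trace_map,
    RO.trace_trace_map] at h
  have h1 : Matrix.fromBlocks (M.map φ) 0 0 (N.map φ) = (Matrix.fromBlocks M 0 0 N).map φ := by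
    simp [Matrix.fromBlocks_map]
  have h2 := ρ.act_onePlus e he (Matrix.fromBlocks M 0 0 N) x
  rw [onePlus, ← hφ, ← h1] at h2
  rw [← h2, h]
  simp

/-- The derivative of `det` at the identity is the matrix trace and that of the norm is the algebra
trace; the exponents become factors. -/
theorem IsHEquivariant.apply_lie {j₁ j₂ : ℤ} {κ : V →ₗ[E] E} (hκ : ρ.IsHEquivariant j₁ j₂ κ)
    (M N : Matrix (Fin n) (Fin n) (RO F E)) (x : V) :
    κ (ρ.lie (Matrix.fromBlocks M 0 0 N) x) =
      (j₁ * Algebra.trace E (RO F E) M.trace + j₂ * Algebra.trace E (RO F E) N.trace) * κ x := by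
  have h := hκ.apply_act_onePlus ρ M N x (DualNumber.eps : DualNumber E) DualNumber.eps_mul_eps
  simpa [TrivSqZeroExt.algebraMap_eq_inl] using congrArg (contract E (TrivSqZeroExt.sndHom E E)) h

end AlgRep

/-! ### Integral elements, embeddings of `F`, and descent from the algebraic closure -/

section Integrality

/-- The structure map `ℤ_p → E`. -/
def zpToField (p : ℕ) [Fact p.Prime] (E : Type u) [Field E] [Algebra ℚ_[p] E] : ℤ_[p] →+* E :=
  (algebraMap ℚ_[p] E).comp (algebraMap ℤ_[p] ℚ_[p])

theorem mem_ringInt {p : ℕ} [Fact p.Prime] {E : Type u} [Field E] [Algebra ℚ_[p] E] {x : E} :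
    x ∈ ringInt p E ↔ (zpToField p E).IsIntegralElem x := Iff.rfl

theorem RingHom.IsIntegralElem.of_int {R S : Type*} [CommRing R] [CommRing S]
    (f : R →+* S) {x : S} (h : (Int.castRingHom S).IsIntegralElem x) : f.IsIntegralElem x := by
  obtain ⟨P, hP, h0⟩ := h
  refine ⟨P.map (Int.castRingHom R), hP.map _, ?_⟩
  rw [Polynomial.eval₂_map, ← h0]
  congr 1
  exact RingHom.ext_int _ _

end Integrality

section Embeddings

variable {F : Type v} [Field F] {E : Type u} [Field E]

theorem embPt_tmul (A : Type u) [CommRing A] [Algebra (AlgebraicClosure E) A]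
    (σ : F →+* AlgebraicClosure E) (a : A) (x : 𝓞 F) :
    embPt A σ (a ⊗ₜ x) = a * algebraMap (AlgebraicClosure E) A (σ x) := by
  simp [embPt]

theorem embPt_map {A B : Type u} [CommRing A] [CommRing B] [Algebra (AlgebraicClosure E) A]
    [Algebra (AlgebraicClosure E) B] (f : A →ₐ[AlgebraicClosure E] B)
    (σ : F →+* AlgebraicClosure E) (x : RO F A) :
    embPt B σ (RO.map F (f : A →+* B) x) = f (embPt A σ x) := by
  induction x using TensorProduct.induction_on with
  | zero => simp
  | add x y hx hy => simp [hx, hy]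
  | tmul a x => simp [embPt_tmul]

theorem isIntegralElem_embPt (p : ℕ) [Fact p.Prime] [Algebra ℚ_[p] E]
    (σ : F →+* AlgebraicClosure E) (z : RO F (ringInt p E)) :
    ((algebraMap E (AlgebraicClosure E)).comp (zpToField p E)).IsIntegralElem
      (embPt (AlgebraicClosure E) σ (RO.map F (algebraMap E (AlgebraicClosure E))
        (RO.map F (ringInt p E).subtype z))) := by
  induction z using TensorProduct.induction_on with
  | zero => simpa using RingHom.isIntegralElem_zero _
  | add x y hx hy => simpa using RingHom.IsIntegralElem.add _ hx hy
  | tmul a x =>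
    rw [RO.map_tmul, RO.map_tmul, embPt_tmul]
    refine RingHom.IsIntegralElem.mul _ ?_ ?_
    · exact RingHom.IsIntegralElem.map (mem_ringInt.mp a.2) _
    · refine RingHom.IsIntegralElem.of_int _ ?_
      have h := RingHom.IsIntegralElem.map (f := algebraMap ℤ F)
        (NumberField.RingOfIntegers.isIntegral_coe x) σ
      rwa [RingHom.ext_int (σ.comp _) (Int.castRingHom _)] at h

end Embeddings

section Descent

variable {E K : Type u} [Field E] [Field K] [Algebra E K] {V : Type w} [AddCommGroup V] [Module E V]

/-- Weights are evaluated only over the algebraic closure, so eigenvalues must be brought back to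
`E`. A functional `φ` on `V` with `φ y = 1` identifies `c` with `φ x`. -/
theorem exists_smul_of_one_tmul_eq {c : K} {x y : V} (hy : y ≠ 0)
    (h : (1 : K) ⊗ₜ[E] x = c ⊗ₜ[E] y) : ∃ d : E, algebraMap E K d = c ∧ x = d • y := by
  obtain ⟨φ, hφ⟩ := Module.Projective.exists_dual_eq_one E hy
  obtain ⟨l, hl⟩ := Module.Projective.exists_dual_eq_one E (one_ne_zero : (1 : K) ≠ 0)
  have h1 : algebraMap E K (φ x) = c := by
    have := congrArg ((TensorProduct.rid E K).toLinearMap ∘ₗ φ.lTensor K) h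
    simpa [hφ, Algebra.smul_def] using this
  refine ⟨φ x, h1, ?_⟩
  have h2 := congrArg (AlgRep.contract V l) h
  rw [← h1, Algebra.algebraMap_eq_smul_one] at h2
  simpa [hl] using h2

end Descent

/-! ### Lie algebra eigenvalues on weight vectors -/

namespace AlgRep

variable {F : Type v} [Field F] [NumberField F] {n : ℕ} {E : Type u} [Field E]  [CharZero E]
  {V : Type w} [AddCommGroup V] [Module E V] (ρ : AlgRep F n E V)

theorem weightChar_sqZeroHom (ν : Weight F E n) {A : Type u} [CommRing A]
    [Algebra (AlgebraicClosure E) A] (e : A) (he : e * e = 0) (z : Idx n → RO F A) :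
    weightChar ν A (fun a => sqZeroHom (e ⊗ₜ 1) (tmul_sq_zero he) (.ofAdd (z a))) =
      sqZeroHom e he (.ofAdd (∑ σ : F →+* AlgebraicClosure E, ∑ a,
        ν σ (pos a) • embPt A σ (z a))) := by
  have h : ∀ (σ : F →+* AlgebraicClosure E) (x : RO F A),
      Units.map (embPt A σ).toMonoidHom (sqZeroHom (e ⊗ₜ 1) (tmul_sq_zero he) (.ofAdd x)) =
        sqZeroHom e he (.ofAdd (embPt A σ x)) := by
    intro σ x
    rw [map_sqZeroHom]
    congr 1
    simp [embPt_tmul]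
  simp only [weightChar, h, sqZeroHom_zpow, ofAdd_sum, map_prod]

theorem snd_one_add_eps_mul {K : Type*} [Field K] (c : K) :
    TrivSqZeroExt.snd (1 + DualNumber.eps * algebraMap K (DualNumber K) c) = c := by
  simp [TrivSqZeroExt.algebraMap_eq_inl]

/-- Evaluate the weight at the point `1 + ε z` of the torus over the dual numbers of the algebraic
closure, then descend the resulting eigenvalue. -/
theorem HasWeight.exists_lie_diagonal {ν : Weight F E n} {x : V} (hx : ρ.HasWeight ν x)
    (hx0 : x ≠ 0) (z : Idx n → RO F E) : ∃ c : E,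
      algebraMap E (AlgebraicClosure E) c = ∑ σ : F →+* AlgebraicClosure E, ∑ a,
        ν σ (pos a) • embPt (AlgebraicClosure E) σ
          (RO.map F (algebraMap E (AlgebraicClosure E)) (z a)) ∧
      ρ.lie (Matrix.diagonal z) x = c • x := by
  let K := AlgebraicClosure E
  let A := DualNumber (AlgebraicClosure E)
  let e : A := DualNumber.eps
  have he : e * e = 0 := DualNumber.eps_mul_eps
  let z' : Idx n → RO F A := fun a => RO.map F (algebraMap E A) (z a)
  have h := hx A (fun a => sqZeroHom (e ⊗ₜ 1) (tmul_sq_zero he) (.ofAdd (z' a)))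
  have hd : diagGL (fun a => sqZeroHom (e ⊗ₜ 1) (tmul_sq_zero he) (.ofAdd (z' a))) =
      onePlus e he ((Matrix.diagonal z).map (RO.map F (algebraMap E A))) := by
    apply Units.ext
    ext a b
    by_cases hab : a = b
    · subst hab
      simp [diagGL, onePlus, sqZeroUnit, z', sqZeroHom_val]
    · simp [diagGL, onePlus, sqZeroUnit, hab]
  rw [hd, act_onePlus, weightChar_sqZeroHom ν e he, sqZeroHom_val] at h
  apply exists_smul_of_one_tmul_eq hx0
  have h3 : ∀ (σ : F →+* K) a, embPt A σ (z' a) =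
      algebraMap K A (embPt K σ (RO.map F (algebraMap E K) (z a))) := by
    intro σ a
    have := embPt_map (Algebra.ofId K A) σ (RO.map F (algebraMap E K) (z a))
    rw [RO.map_map] at this
    exact this
  have h5 : (∑ σ : F →+* AlgebraicClosure E, ∑ a, ν σ (pos a) • embPt A σ (z' a)) =
      algebraMap K A (∑ σ : F →+* AlgebraicClosure E, ∑ a, ν σ (pos a) •
        embPt K σ (RO.map F (algebraMap E K) (z a))) := by
    simp only [map_sum, map_zsmul, h3]
  rw [h5] at h
  generalize (∑ σ : F →+* AlgebraicClosure E, ∑ a, ν σ (pos a) •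
    embPt K σ (RO.map F (algebraMap E K) (z a))) = c at h
  have h2 := congrArg ((TrivSqZeroExt.sndHom K K).restrictScalars E |>.rTensor V) h
  have h4 : TrivSqZeroExt.snd (1 + e * algebraMap K A c) = c := snd_one_add_eps_mul c
  simpa [e, h4] using h2

/-- The strictly lower part kills `x` by invariance under `N⁻`. The diagonal part acts by an
integral combination of the `σ(Z a a)`, which are integral over `ℤ_p`. -/
theorem IsLowestWeightVector.exists_lie_lower {μ : Weight F E n} {x : V}
    (hx : ρ.IsLowestWeightVector μ x) (p : ℕ) [Fact p.Prime] [Algebra ℚ_[p] E]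
    (Z : Matrix (Idx n) (Idx n) (RO F (ringInt p E))) (hZ : ∀ a b, pos a < pos b → Z a b = 0) :
    ∃ c ∈ ringInt p E, ρ.lie (Z.map (RO.map F (ringInt p E).subtype)) x = c • x := by
  set Z' := Z.map (RO.map F (ringInt p E).subtype) with hZ'
  obtain ⟨c, hc, hcx⟩ := hx.2.1.exists_lie_diagonal ρ hx.1 Z'.diag
  have h0 : ρ.lie (Z' - Matrix.diagonal Z'.diag) x = 0 := by
    have h1 := hx.2.2 (DualNumber E) (onePlusEps (Z' - Matrix.diagonal Z'.diag)) (by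
      intro a b hab
      rcases hab.lt_or_eq with hab | hab
      · have : a ≠ b := fun h => by simp [h] at hab
        simp [onePlusEps, epsMul, Z', this, hZ a b hab]
      · obtain rfl := pos.injective hab
        simp [onePlusEps, epsMul])
    rw [act_onePlusEps, add_eq_left] at h1
    exact eq_of_eps_tmul (E := E) (by rw [h1, TensorProduct.tmul_zero])
  refine ⟨c, ?_, ?_⟩
  · rw [mem_ringInt]
    refine RingHom.IsIntegralElem.of_map (g := algebraMap E (AlgebraicClosure E))
      (algebraMap E (AlgebraicClosure E)).injective ?_
    rw [hc]
    let S : Subring (AlgebraicClosure E) :=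
      letI := ((algebraMap E (AlgebraicClosure E)).comp (zpToField p E)).toAlgebra
      (integralClosure ℤ_[p] (AlgebraicClosure E)).toSubring
    refine S.sum_mem fun σ _ => S.sum_mem fun a _ => S.zsmul_mem ?_ _
    exact isIntegralElem_embPt p σ (Z a a)
  · rw [← hcx, ← sub_add_cancel Z' (Matrix.diagonal Z'.diag), lie_add, LinearMap.add_apply, h0,
      zero_add]
    simp

end AlgRep

/-! ### Filtration by the number of operators applied -/

section Filtration

variable {O : Type*} [CommRing O] {V : Type w} [AddCommGroup V] [Module O V]

/-- The elements obtained from multiples of `x` by applying at most `k` operators in `L`. -/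
def opFiltration (L : Set (Module.End O V)) (x : V) : ℕ → Submodule O V
  | 0 => Submodule.span O {x}
  | k + 1 => opFiltration L x k ⊔
      Submodule.span O {y | ∃ X ∈ L, ∃ m ∈ opFiltration L x k, y = X m}

variable {L : Set (Module.End O V)} {x : V}

theorem opFiltration_mono : Monotone (opFiltration L x) :=
  monotone_nat_of_le_succ fun _ => le_sup_left

theorem apply_mem_opFiltration {X : Module.End O V} (hX : X ∈ L) {k : ℕ} {m : V}
    (hm : m ∈ opFiltration L x k) : X m ∈ opFiltration L x (k + 1) :=
  Submodule.mem_sup_right (Submodule.subset_span ⟨X, hX, m, hm, rfl⟩)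

theorem exists_apply_mem_opFiltration {T : Module.End O V} (hT : T ∈ Algebra.adjoin O L) :
    ∀ k, ∀ m ∈ opFiltration L x k, ∃ l, T m ∈ opFiltration L x l := by
  induction hT using Algebra.adjoin_induction with
  | mem X hX => exact fun k m hm => ⟨k + 1, apply_mem_opFiltration hX hm⟩
  | algebraMap r => exact fun k m hm => ⟨k, Submodule.smul_mem _ r hm⟩
  | add S T _ _ hS hT =>
    intro k m hm
    obtain ⟨i, hi⟩ := hS k m hm
    obtain ⟨j, hj⟩ := hT k m hm
    exact ⟨max i j, Submodule.add_mem _ (opFiltration_mono (le_max_left i j) hi)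
      (opFiltration_mono (le_max_right i j) hj)⟩
  | mul S T _ _ hS hT =>
    intro k m hm
    obtain ⟨j, hj⟩ := hT k m hm
    exact hS j _ hj

/-- Write `Z X = X Z + [Z, X]`: as the bracket is again in `L`, moving `Z` to the right, down to its
eigenvector `x`, never raises the degree. -/
theorem stable_opFiltration {Z : Module.End O V} (hx : Z x ∈ Submodule.span O {x})
    (hZ : ∀ X ∈ L, Z * X - X * Z ∈ L) (k : ℕ) :
    ∀ m ∈ opFiltration L x k, Z m ∈ opFiltration L x k := by
  induction k with
  | zero =>
    intro m hm
    obtain ⟨r, rfl⟩ := Submodule.mem_span_singleton.mp hm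
    rw [map_smul]
    exact Submodule.smul_mem _ _ hx
  | succ k ih =>
    intro m hm
    have : opFiltration L x (k + 1) ≤ (opFiltration L x (k + 1)).comap Z := by
      refine sup_le (fun m hm => Submodule.mem_sup_left (ih m hm))
        (Submodule.span_le.mpr ?_)
      rintro _ ⟨X, hX, m, hm, rfl⟩
      have h : Z (X m) = X (Z m) + (Z * X - X * Z) m := by simp
      change Z (X m) ∈ opFiltration L x (k + 1)
      rw [h]
      exact Submodule.add_mem _ (apply_mem_opFiltration hX (ih m hm))
        (apply_mem_opFiltration (hZ X hX) hm)
    exact this hm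

/-- If every operator in `L` is the sum of one that preserves `S` and one that normalizes `L` and
has `x` as an eigenvector, then the algebra generated by `L` maps `x` into `S`. -/
theorem adjoin_apply_mem (S : Submodule O V) (hx : x ∈ S)
    (hL : ∀ X ∈ L, ∃ Y Z : Module.End O V, X = Y + Z ∧ (∀ m ∈ S, Y m ∈ S) ∧
      Z x ∈ Submodule.span O {x} ∧ ∀ X' ∈ L, Z * X' - X' * Z ∈ L)
    {T : Module.End O V} (hT : T ∈ Algebra.adjoin O L) : T x ∈ S := by
  have h : ∀ k, opFiltration L x k ≤ S := by
    intro k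
    induction k with
    | zero => exact (Submodule.span_singleton_le_iff_mem _ _).mpr hx
    | succ k ih =>
      refine sup_le ih (Submodule.span_le.mpr ?_)
      rintro _ ⟨X, hX, m, hm, rfl⟩
      obtain ⟨Y, Z, rfl, hY, hZx, hZ⟩ := hL X hX
      -- Here `m` has degree `k`: `Y` keeps it in `S`, while `Z m` still has degree `k` and is
      -- covered by the induction hypothesis.
      exact S.add_mem (hY m (ih hm)) (ih (stable_opFiltration hZx hZ k m hm))
  obtain ⟨l, hl⟩ := exists_apply_mem_opFiltration hT 0 x (Submodule.mem_span_singleton_self x)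
  exact h l hl

end Filtration

/-! ### Block matrices relative to `ξ` -/

section Blocks

variable {n : ℕ} {R : Type*} [CommRing R]

theorem wMat_mul_apply (X : Matrix (Fin n) (Fin n) R) (i j : Fin n) :
    (wMat n R * X) i j = X i.rev j := by
  simp [wMat, Matrix.mul_apply, ← Fin.rev_eq_iff]

theorem mul_wMat_apply (X : Matrix (Fin n) (Fin n) R) (i j : Fin n) :
    (X * wMat n R) i j = X i j.rev := by
  simp [wMat, Matrix.mul_apply]

/-- Matrices that are block lower triangular modulo `q` split into a part conjugate under `ξ` to a
block diagonal matrix, whose blocks are congruent modulo `q`, and a lower triangular part. -/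
theorem exists_block_decomposition (q : R) (X : Matrix (Idx n) (Idx n) R)
    (b : Matrix (Fin n) (Fin n) R) (hb : X.toBlocks₁₂ = q • b) :
    ∃ (Y Z : Matrix (Idx n) (Idx n) R) (N r : Matrix (Fin n) (Fin n) R), X = Y + Z ∧
      (xi n R).val * Y = Matrix.fromBlocks (N + q • r) 0 0 N * (xi n R).val ∧
      ∀ i j, pos i < pos j → Z i j = 0 := by
  let r := b * wMat n R
  -- The part of `N` above the diagonal absorbs that of the upper left block. Conjugation by `w_n`
  -- reverses the order of indices, so the part below the diagonal is free to absorb what lies above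
  -- the diagonal in the lower right block.
  let N : Matrix (Fin n) (Fin n) R := Matrix.of fun i j =>
    if i < j then X.toBlocks₁₁ i j - q * r i j else
      if j < i then X.toBlocks₂₂ i.rev j.rev else 0
  refine ⟨Matrix.fromBlocks (N + q • r) (q • b) 0 (wMat n R * N * wMat n R),
    Matrix.fromBlocks (X.toBlocks₁₁ - (N + q • r)) 0 X.toBlocks₂₁
      (X.toBlocks₂₂ - wMat n R * N * wMat n R), N, r, ?_, ?_, ?_⟩
  · conv_lhs => rw [← Matrix.fromBlocks_toBlocks X, hb]
    simp [Matrix.fromBlocks_add]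
  · have h : r * wMat n R = b := by simp only [r, mul_assoc, wMat_mul_self, mul_one]
    simp only [xi, Matrix.fromBlocks_multiply]
    simp [← mul_assoc, wMat_mul_self, add_mul, h, add_comm]
  · rintro (i | i) (j | j) hij
    · have hij : i < j := hij
      simp [N, hij]
    · simp
    · simp [Fin.lt_def] at hij
      omega
    · have hij : i < j := by simpa using hij
      simp [wMat_mul_apply, mul_wMat_apply, N, hij, hij.not_gt, Fin.rev_lt_rev]

theorem toBlocks₁₂_commutator (q : R) (X Z : Matrix (Idx n) (Idx n) R)
    (hX : ∃ b, X.toBlocks₁₂ = q • b) (hZ : ∀ i j, pos i < pos j → Z i j = 0) :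
    ∃ b, (Z * X - X * Z).toBlocks₁₂ = q • b := by
  obtain ⟨b, hb⟩ := hX
  have hZ' : Z.toBlocks₁₂ = 0 := by
    ext i j
    refine hZ _ _ ?_
    simp [Fin.lt_def]
    omega
  refine ⟨Z.toBlocks₁₁ * b - b * Z.toBlocks₂₂, ?_⟩
  have h1 : Z * X - X * Z = Matrix.fromBlocks Z.toBlocks₁₁ 0 Z.toBlocks₂₁ Z.toBlocks₂₂ *
      Matrix.fromBlocks X.toBlocks₁₁ (q • b) X.toBlocks₂₁ X.toBlocks₂₂ -
      Matrix.fromBlocks X.toBlocks₁₁ (q • b) X.toBlocks₂₁ X.toBlocks₂₂ *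
      Matrix.fromBlocks Z.toBlocks₁₁ 0 Z.toBlocks₂₁ Z.toBlocks₂₂ := by
    rw [← hb, ← hZ', Matrix.fromBlocks_toBlocks, Matrix.fromBlocks_toBlocks]
  rw [h1, Matrix.fromBlocks_multiply, Matrix.fromBlocks_multiply, sub_eq_add_neg,
    Matrix.fromBlocks_neg, Matrix.fromBlocks_add, Matrix.toBlocks_fromBlocks₁₂]
  simp [sub_eq_add_neg]

end Blocks

/-! ### Vectors on which two functionals are congruent -/

section Congruence

variable {E : Type u} [Field E] {V : Type w} [AddCommGroup V] [Module E V]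

/-- The vectors on which two functionals are integral and congruent modulo `q`. -/
def congruenceSubmodule (O : Subring E) (q : E) (ψ ψ' : V →ₗ[E] E) : Submodule O V where
  carrier := {x | ψ x ∈ O ∧ ψ' x ∈ O ∧ ∃ c ∈ O, ψ x - ψ' x = q * c}
  zero_mem' := ⟨by simp, by simp, 0, O.zero_mem, by simp⟩
  add_mem' := by
    rintro x y ⟨h1, h2, c, hc, h3⟩ ⟨h4, h5, d, hd, h6⟩
    refine ⟨?_, ?_, c + d, O.add_mem hc hd, ?_⟩
    · rw [map_add]; exact O.add_mem h1 h4
    · rw [map_add]; exact O.add_mem h2 h5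
    · rw [map_add, map_add]; linear_combination h3 + h6
  smul_mem' := by
    rintro ⟨r, hr⟩ x ⟨h1, h2, c, hc, h3⟩
    have e1 : ψ (r • x) = r * ψ x := map_smul _ _ _
    have e2 : ψ' (r • x) = r * ψ' x := map_smul _ _ _
    refine ⟨?_, ?_, r * c, O.mul_mem hr hc, ?_⟩
    · change ψ (r • x) ∈ O
      rw [e1]; exact O.mul_mem hr h1
    · change ψ' (r • x) ∈ O
      rw [e2]; exact O.mul_mem hr h2
    · change ψ (r • x) - ψ' (r • x) = _
      rw [e1, e2]; linear_combination r * h3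

/-- This is `a ψ - a' ψ' = a (ψ - ψ') + (a - a') ψ'`. -/
theorem apply_mem_congruenceSubmodule {O : Subring E} {q : E} {ψ ψ' : V →ₗ[E] E}
    {Y : Module.End E V} {a a' s : E} (ha : a ∈ O) (ha' : a' ∈ O) (hs : s ∈ O)
    (has : a - a' = q * s) (h : ∀ x, ψ (Y x) = a * ψ x) (h' : ∀ x, ψ' (Y x) = a' * ψ' x) {x : V}
    (hx : x ∈ congruenceSubmodule O q ψ ψ') : Y x ∈ congruenceSubmodule O q ψ ψ' := by
  obtain ⟨h1, h2, c, hc, h3⟩ := hx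
  refine ⟨?_, ?_, a * c + s * ψ' x, O.add_mem (O.mul_mem ha hc) (O.mul_mem hs h2), ?_⟩
  · rw [h]; exact O.mul_mem ha h1
  · rw [h']; exact O.mul_mem ha' h2
  · rw [h, h']; linear_combination a * h3 + ψ' x * has

/-- Restriction of scalars of endomorphisms to a subring. -/
def endRestrict (O : Subring E) (V : Type w) [AddCommGroup V] [Module E V] :
    Module.End E V →ₐ[O] Module.End O V where
  toFun f := f.restrictScalars O
  map_one' := rfl
  map_mul' _ _ := rfl
  map_zero' := rfl
  map_add' _ _ := rfl
  commutes' _ := rfl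

end Congruence

theorem map_wMat {n : ℕ} {R S : Type*} [CommRing R] [CommRing S] (f : R →+* S) :
    (wMat n R).map f = wMat n S := by
  ext i j
  by_cases h : i = j.rev <;> simp [wMat, h]

theorem map_xi {n : ℕ} {R S : Type*} [CommRing R] [CommRing S] (f : R →+* S) :
    (xi n R).val.map f = (xi n S).val := by
  simp [xi, Matrix.fromBlocks_map, map_wMat]

/-! ### Stability of the congruence under the parahoric operators -/

namespace AlgRep

variable {F : Type v} [Field F] {n : ℕ} {E : Type u} [Field E]
  {V : Type w} [AddCommGroup V] [Module E V] (ρ : AlgRep F n E V)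

/-- The operators `dρ(X)`, for `X` over `O ⊗ 𝓞_F` block lower triangular modulo `p^β`. -/
def parahoricOps (p : ℕ) (O : Subring E) (β : ℕ) : Set (Module.End E V) :=
  {T | ∃ X : Matrix (Idx n) (Idx n) (RO F O), (∃ b, X.toBlocks₁₂ = ((p : RO F O) ^ β) • b) ∧
      T = ρ.lie (X.map (RO.map F O.subtype))}

theorem trace_mem [NumberField F] (O : Subring E) (M : Matrix (Fin n) (Fin n) (RO F O)) :
    Algebra.trace E (RO F E) (M.map (RO.map F O.subtype)).trace ∈ O := by
  rw [RO.trace_trace_map]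
  exact Subtype.coe_prop _

/-- The reason for enlarging `𝔫_O`: strictly upper triangular matrices are in general not normalized
by lower triangular ones, whereas block lower triangular matrices modulo `p^β` are. -/
theorem commutator_mem_parahoricOps (p : ℕ) (O : Subring E) (β : ℕ)
    (Z : Matrix (Idx n) (Idx n) (RO F O)) (hZ : ∀ i j, pos i < pos j → Z i j = 0)
    {T : Module.End E V} (hT : T ∈ ρ.parahoricOps p O β) :
    ρ.lie (Z.map (RO.map F O.subtype)) * T - T * ρ.lie (Z.map (RO.map F O.subtype)) ∈
      ρ.parahoricOps p O β := by
  obtain ⟨X, hX, rfl⟩ := hT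
  refine ⟨Z * X - X * Z, toBlocks₁₂_commutator _ X Z hX hZ, ?_⟩
  ext x
  simp only [LinearMap.sub_apply, Module.End.mul_apply]
  rw [lie_commutator, add_sub_cancel_left, Matrix.map_sub _ (by simp), Matrix.map_mul,
    Matrix.map_mul]

theorem trace_trace_add_smul [NumberField F] (O : Subring E) (p β : ℕ)
    (N r : Matrix (Fin n) (Fin n) (RO F O)) :
    Algebra.trace E (RO F E) ((N + ((p : RO F O) ^ β) • r).map (RO.map F O.subtype)).trace =
      Algebra.trace E (RO F E) (N.map (RO.map F O.subtype)).trace +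
        (p : E) ^ β * Algebra.trace E (RO F E) (r.map (RO.map F O.subtype)).trace := by
  rw [RO.trace_trace_map, RO.trace_trace_map, RO.trace_trace_map, Matrix.trace_add,
    Matrix.trace_smul, smul_eq_mul, ← Nat.cast_pow, ← nsmul_eq_mul, map_add, map_nsmul, map_add,
    map_nsmul]
  simp

/-- The functional `x ↦ κ°(ξ x)`. -/
def normalizedXi (κ : V →ₗ[E] E) (v₀ : V) : V →ₗ[E] E :=
  (κ (ρ.onPts (xi n (RO F E)) v₀))⁻¹ • (κ ∘ₗ ρ.onPts (xi n (RO F E)))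

theorem normalizedXi_apply (κ : V →ₗ[E] E) (v₀ x : V) :
    ρ.normalizedXi κ v₀ x = ρ.normalized κ v₀ (ρ.onPts (xi n (RO F E)) x) := by
  simp [normalizedXi, normalized, div_eq_inv_mul]

theorem normalizedXi_lie [NumberField F] {j₁ j₂ : ℤ} {κ : V →ₗ[E] E}
    (hκ : ρ.IsHEquivariant j₁ j₂ κ)
    (v₀ : V) {Y : Matrix (Idx n) (Idx n) (RO F E)} {M N : Matrix (Fin n) (Fin n) (RO F E)}
    (hY : (xi n (RO F E)).val * Y = Matrix.fromBlocks M 0 0 N * (xi n (RO F E)).val) (x : V) :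
    ρ.normalizedXi κ v₀ (ρ.lie Y x) = (j₁ * Algebra.trace E (RO F E) M.trace +
      j₂ * Algebra.trace E (RO F E) N.trace) * ρ.normalizedXi κ v₀ x := by
  simp only [normalizedXi, LinearMap.smul_apply, LinearMap.comp_apply, smul_eq_mul]
  rw [ρ.onPts_lie _ _ _ hY, hκ.apply_lie ρ]
  ring

theorem exists_parahoric_decomposition [NumberField F] (p : ℕ) (O : Subring E) (v₀ : V)
    {j j' w₀ : ℤ} {κ κ' : V →ₗ[E] E} (hκ : ρ.IsHEquivariant j (w₀ - j) κ)
    (hκ' : ρ.IsHEquivariant j' (w₀ - j') κ') (β : ℕ) {T : Module.End E V}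
    (hT : T ∈ ρ.parahoricOps p O β) :
    ∃ (Y : Module.End E V) (Z : Matrix (Idx n) (Idx n) (RO F O)),
      T = Y + ρ.lie (Z.map (RO.map F O.subtype)) ∧ (∀ i j, pos i < pos j → Z i j = 0) ∧
      ∀ x ∈ congruenceSubmodule O ((p : E) ^ β) (ρ.normalizedXi κ v₀) (ρ.normalizedXi κ' v₀),
        Y x ∈ congruenceSubmodule O ((p : E) ^ β) (ρ.normalizedXi κ v₀)
          (ρ.normalizedXi κ' v₀) := by
  obtain ⟨X, ⟨b, hb⟩, rfl⟩ := hT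
  obtain ⟨Y, Z, N, r, rfl, hY, hZ⟩ := exists_block_decomposition _ X b hb
  set f := RO.map F O.subtype with hf
  refine ⟨ρ.lie (Y.map f), Z, ?_, hZ, ?_⟩
  · rw [Matrix.map_add _ (by simp), lie_add]
  · intro x hx
    have hconj : (xi n (RO F E)).val * Y.map f = Matrix.fromBlocks
        ((N + ((p : RO F O) ^ β) • r).map f) 0 0 (N.map f) * (xi n (RO F E)).val := by
      have := congrArg (fun A => A.map f) hY
      rw [Matrix.map_mul, Matrix.map_mul, map_xi, Matrix.fromBlocks_map] at this
      rw [this, Matrix.map_zero _ (map_zero f)]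
    have hint : ∀ k : ℤ, (k : E) ∈ O := fun k => intCast_mem O k
    have hchar : ∀ k : ℤ, ((k : E) * Algebra.trace E (RO F E)
        ((N + ((p : RO F O) ^ β) • r).map f).trace +
          ((w₀ - k : ℤ) : E) * Algebra.trace E (RO F E) (N.map f).trace) ∈ O :=
      fun k => O.add_mem (O.mul_mem (hint _) (trace_mem O _)) (O.mul_mem (hint _) (trace_mem O _))
    -- The eigenvalue for `k` is `w₀ Tr(tr N) + k p^β Tr(tr r)`, so those for `j` and `j'` differ by
    -- `p^β (j - j') Tr(tr r)`.
    refine apply_mem_congruenceSubmodule (Y := ρ.lie (Y.map f)) (hchar j) (hchar j')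
      (O.mul_mem (hint (j - j')) (trace_mem O r)) ?_
      (ρ.normalizedXi_lie hκ v₀ hconj) (ρ.normalizedXi_lie hκ' v₀ hconj) hx
    rw [hf, trace_trace_add_smul]
    push_cast
    ring

theorem mem_congruenceSubmodule_of_mem_adjoin [NumberField F] (p : ℕ) (O : Subring E) {v₀ : V}
    (hv₀ : ∀ Z : Matrix (Idx n) (Idx n) (RO F O), (∀ i j, pos i < pos j → Z i j = 0) →
      ∃ c ∈ O, ρ.lie (Z.map (RO.map F O.subtype)) v₀ = c • v₀)
    {j j' w₀ : ℤ} {κ κ' : V →ₗ[E] E} (hκ : ρ.IsHEquivariant j (w₀ - j) κ)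
    (hκ' : ρ.IsHEquivariant j' (w₀ - j') κ') (h0 : κ (ρ.onPts (xi n (RO F E)) v₀) ≠ 0)
    (h0' : κ' (ρ.onPts (xi n (RO F E)) v₀) ≠ 0) (β : ℕ) {T : Module.End E V}
    (hT : T ∈ Algebra.adjoin O (ρ.parahoricOps p O β)) :
    T v₀ ∈ congruenceSubmodule O ((p : E) ^ β) (ρ.normalizedXi κ v₀) (ρ.normalizedXi κ' v₀) := by
  have hT' : endRestrict O V T ∈ Algebra.adjoin O (endRestrict O V '' ρ.parahoricOps p O β) := by
    rw [← AlgHom.map_adjoin]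
    exact ⟨T, hT, rfl⟩
  refine adjoin_apply_mem _ ?_ ?_ hT'
  · have e1 : ρ.normalizedXi κ v₀ v₀ = 1 := by rw [normalizedXi_apply]; exact div_self h0
    have e2 : ρ.normalizedXi κ' v₀ v₀ = 1 := by rw [normalizedXi_apply]; exact div_self h0'
    exact ⟨e1 ▸ O.one_mem, e2 ▸ O.one_mem, 0, O.zero_mem, by rw [e1, e2]; simp⟩
  · rintro _ ⟨X, hX, rfl⟩
    obtain ⟨Y, Z, rfl, hZ, hY⟩ := ρ.exists_parahoric_decomposition p O v₀ hκ hκ' β hX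
    refine ⟨endRestrict O V Y, endRestrict O V (ρ.lie (Z.map (RO.map F O.subtype))),
      map_add _ _ _, hY, ?_, ?_⟩
    · obtain ⟨c, hc, hcx⟩ := hv₀ Z hZ
      exact Submodule.mem_span_singleton.mpr ⟨⟨c, hc⟩, hcx.symm⟩
    · rintro _ ⟨T', hT', rfl⟩
      exact ⟨_, ρ.commutator_mem_parahoricOps p O β Z hZ hT', by rw [map_sub, map_mul, map_mul]⟩

end AlgRep

section Blocks

variable {n : ℕ} {R : Type*} [CommRing R]

theorem fromBlocks_smul_one_mul (q q' : R) :
    Matrix.fromBlocks (q • (1 : Matrix (Fin n) (Fin n) R)) 0 0 (1 : Matrix (Fin n) (Fin n) R) *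
      Matrix.fromBlocks (q' • 1) 0 0 1 = Matrix.fromBlocks ((q * q') • 1) 0 0 1 := by
  simp [Matrix.fromBlocks_multiply, smul_smul, mul_comm]

theorem fromBlocks_smul_one_conj (q : R) (a b d : Matrix (Fin n) (Fin n) R) :
    Matrix.fromBlocks (q • (1 : Matrix (Fin n) (Fin n) R)) 0 0 (1 : Matrix (Fin n) (Fin n) R) *
      Matrix.fromBlocks a b 0 d =
    Matrix.fromBlocks a (q • b) 0 d * Matrix.fromBlocks (q • 1) 0 0 1 := by
  simp [Matrix.fromBlocks_multiply]

end Blocks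

/-! ### Conjugation by `t_p^β` and its eigenvalue on `v₀` -/

namespace AlgRep

section Torus

variable {F : Type v} [Field F] {n : ℕ} {E : Type u} [Field E] [CharZero E]
  {V : Type w} [AddCommGroup V] [Module E V] (ρ : AlgRep F n E V) (p : ℕ) [Fact p.Prime]

theorem tp_pow_val (β : ℕ) : (tp F n E p ^ β).val =
    Matrix.fromBlocks (((p : RO F E) ^ β) • (1 : Matrix (Fin n) (Fin n) (RO F E))) 0 0 1 := by
  induction β with
  | zero => simp
  | succ β ih =>
    rw [pow_succ, Units.val_mul, ih]
    have h : (tp F n E p).val =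
        Matrix.fromBlocks ((p : RO F E) • (1 : Matrix (Fin n) (Fin n) (RO F E))) 0 0 1 := by
      simp [tp, iota, Matrix.smul_one_eq_diagonal, ← Matrix.diagonal_natCast]
    rw [h, pow_succ]
    exact fromBlocks_smul_one_mul _ _

/-- Conjugation by `t_p^β` multiplies the upper right block by `p^β` and fixes the diagonal blocks.
Membership of `T'` in `envN` gives the inclusion in `ξ V_O`; membership in the parahoric algebra
gives the congruence. -/
theorem exists_conj_tp_pow (O : Subring E) (β : ℕ) {T : Module.End E V} (hT : T ∈ ρ.envN O) :
    ∃ T' ∈ ρ.envN O, T' ∈ Algebra.adjoin O (ρ.parahoricOps p O β) ∧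
      ∀ x, ρ.onPts (tp F n E p ^ β) (T x) = T' (ρ.onPts (tp F n E p ^ β) x) := by
  induction hT using Algebra.adjoin_induction with
  | mem T hT =>
    obtain ⟨X, hX, rfl⟩ := hT
    have h21 : X.toBlocks₂₁ = 0 := by
      ext i j
      exact hX _ _ (by simp [Fin.le_def]; omega)
    let X' := Matrix.fromBlocks X.toBlocks₁₁ (((p : RO F O) ^ β) • X.toBlocks₁₂) 0 X.toBlocks₂₂
    refine ⟨ρ.lie (X'.map (RO.map F O.subtype)), Algebra.subset_adjoin ⟨X', ?_, rfl⟩,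
      Algebra.subset_adjoin ⟨X', ⟨X.toBlocks₁₂, by simp [X']⟩, rfl⟩, fun x => ?_⟩
    · rintro (i | i) (j | j) hij
      · exact hX _ _ hij
      · simp [Fin.le_def] at hij
        omega
      · rfl
      · exact hX _ _ hij
    · apply ρ.onPts_lie
      rw [tp_pow_val]
      conv_lhs => rw [← Matrix.fromBlocks_toBlocks X, h21]
      rw [Matrix.fromBlocks_map, Matrix.fromBlocks_map, Matrix.map_zero _ (map_zero _)]
      have h1 : (((p : RO F O) ^ β) • X.toBlocks₁₂).map (RO.map F O.subtype) =
          ((p : RO F E) ^ β) • X.toBlocks₁₂.map (RO.map F O.subtype) := by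
        ext i j
        simp
      rw [h1]
      exact fromBlocks_smul_one_conj _ _ _ _
  | algebraMap r =>
    exact ⟨algebraMap O _ r, Subalgebra.algebraMap_mem _ r, Subalgebra.algebraMap_mem _ r,
      fun x => map_smul (ρ.onPts (tp F n E p ^ β)) (r : E) x⟩
  | add S T _ _ hS hT =>
    obtain ⟨S', h1, h2, h3⟩ := hS
    obtain ⟨T', h4, h5, h6⟩ := hT
    exact ⟨S' + T', add_mem h1 h4, add_mem h2 h5, fun x => by simp [h3, h6]⟩
  | mul S T _ _ hS hT =>
    obtain ⟨S', h1, h2, h3⟩ := hS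
    obtain ⟨T', h4, h5, h6⟩ := hT
    exact ⟨S' * T', mul_mem h1 h4, mul_mem h2 h5, fun x => by simp [h3, h6]⟩

theorem map_tp (A : Type u) [CommRing A] [Algebra E A] (a : Aˣ) (ha : a.val = p) :
    Matrix.GeneralLinearGroup.map (RO.map F (algebraMap E A)) (tp F n E p) =
      diagGL (Sum.elim (fun _ => Units.map (algebraMap A (RO F A)).toMonoidHom a)
        (fun _ => 1)) := by
  apply Units.ext
  ext x y
  have h := tp_pow_val (F := F) (n := n) (E := E) p 1
  rw [pow_one] at h
  change RO.map F (algebraMap E A) ((tp F n E p).val x y) = _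
  rw [h]
  rcases x with x | x <;> rcases y with y | y <;> by_cases hxy : x = y <;>
    simp [diagGL, hxy, ha]

variable [NumberField F]

theorem weightChar_elim (ν : Weight F E n) {A : Type u} [CommRing A]
    [Algebra (AlgebraicClosure E) A] (a : Aˣ) :
    weightChar ν A (Sum.elim (fun _ => Units.map (algebraMap A (RO F A)).toMonoidHom a)
      (fun _ => 1)) = ∏ σ : F →+* AlgebraicClosure E, ∏ i : Fin n, a ^ ν σ (pos (Sum.inl i)) := by
  have h : ∀ σ : F →+* AlgebraicClosure E, Units.map (embPt A σ).toMonoidHom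
      (Units.map (algebraMap A (RO F A)).toMonoidHom a) = a := by
    intro σ
    ext
    simp [embPt_tmul, Algebra.TensorProduct.algebraMap_apply]
  simp only [weightChar, Fintype.prod_sum_type, Sum.elim_inl, Sum.elim_inr, h, map_one, one_zpow,
    Finset.prod_const_one, mul_one]

theorem HasWeight.one_tmul_onPts_tp {ν : Weight F E n} {x : V} (hx : ρ.HasWeight ν x)
    {A : Type u} [CommRing A] [Algebra E A] [Algebra (AlgebraicClosure E) A]
    [IsScalarTower E (AlgebraicClosure E) A] (a : Aˣ) (ha : a.val = p) :
    (1 : A) ⊗ₜ[E] ρ.onPts (tp F n E p) x =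
      (∏ σ : F →+* AlgebraicClosure E, ∏ i : Fin n, a ^ ν σ (pos (Sum.inl i)) : Aˣ).val ⊗ₜ x := by
  rw [← weightChar_elim, ← hx, ← map_tp (E := E) p A a ha, act_map_one_tmul]

/-- The weight of `v₀` is `-μ^∨`, so `t_p` acts on it by `μ^∨(t_p)⁻¹`. -/
theorem dualAtTp_smul_onPts_tp {μ : Weight F E n} {v₀ : V} (hv₀ : ρ.IsLowestWeightVector μ v₀) :
    dualAtTp p μ • ρ.onPts (tp F n E p) v₀ = v₀ := by
  have hp : (p : AlgebraicClosure E) ≠ 0 := Nat.cast_ne_zero.mpr (Fact.out : p.Prime).ne_zero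
  have h1 := hv₀.2.1.one_tmul_onPts_tp ρ p (Units.mk0 _ hp) rfl
  obtain ⟨d, hd, hd'⟩ := exists_smul_of_one_tmul_eq hv₀.1 h1
  have h5 : dualAtTp p μ * d = 1 := by
    apply (algebraMap E (AlgebraicClosure E)).injective
    rw [map_mul, hd, map_one]
    have h2 : algebraMap E (AlgebraicClosure E) (dualAtTp p μ) =
        (∏ σ : F →+* AlgebraicClosure E, ∏ i : Fin n,
          Units.mk0 _ hp ^ dualWeight μ σ (pos (Sum.inl i)) : (AlgebraicClosure E)ˣ) := by
      simp only [dualAtTp, map_prod, map_zpow₀, map_natCast, Units.coe_prod,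
        Units.val_zpow_eq_zpow_val, Units.val_mk0]
    rw [h2]
    simp only [Pi.neg_apply, zpow_neg, Finset.prod_inv_distrib, Units.mul_inv]
  rw [hd', smul_smul, h5, one_smul]

theorem dualAtTp_pow_smul_onPts_tp_pow {μ : Weight F E n} {v₀ : V}
    (hv₀ : ρ.IsLowestWeightVector μ v₀) (β : ℕ) :
    dualAtTp p μ ^ β • ρ.onPts (tp F n E p ^ β) v₀ = v₀ := by
  induction β with
  | zero => simp [onPts_one]
  | succ β ih =>
    rw [pow_succ, pow_succ, onPts_mul, mul_smul, ← map_smul, dualAtTp_smul_onPts_tp ρ p hv₀, ih]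

theorem bullet_apply {μ : Weight F E n} {v₀ : V} (hv₀ : ρ.IsLowestWeightVector μ v₀)
    {β : ℕ} {T T' : Module.End E V}
    (h : ∀ x, ρ.onPts (tp F n E p ^ β) (T x) = T' (ρ.onPts (tp F n E p ^ β) x)) :
    ρ.bullet p μ β (T v₀) = ρ.onPts (xi n (RO F E)) (T' v₀) := by
  rw [bullet, onPts_mul, h, ← map_smul, ← map_smul, dualAtTp_pow_smul_onPts_tp_pow ρ p hv₀]

end Torus

theorem envN_le_adjoin_parahoricOps {F : Type v} [Field F] {n : ℕ} {E : Type u} [Field E]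
    {V : Type w} [AddCommGroup V] [Module E V] (ρ : AlgRep F n E V) (p : ℕ) (O : Subring E) :
    ρ.envN O ≤ Algebra.adjoin O (ρ.parahoricOps p O 0) := by
  refine Algebra.adjoin_mono ?_
  rintro _ ⟨X, _, rfl⟩
  exact ⟨X, ⟨X.toBlocks₁₂, by simp⟩, rfl⟩

end AlgRep

/-! ### LU decomposition and the formal open orbit of `ξ` -/

section Factorization

variable {R R' : Type*} [CommRing R] [CommRing R']

/-- A matrix reducing to the identity along a local homomorphism has an LU decomposition. -/
theorem exists_lower_mul_upper (f : R →+* R') [IsLocalHom f] :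
    ∀ (n : ℕ) (M : Matrix (Fin n) (Fin n) R), M.map f = 1 →
      ∃ L U : Matrix (Fin n) (Fin n) R, M = L * U ∧ (∀ i j, i < j → L i j = 0) ∧
        (∀ i, L i i = 1) ∧ (∀ i j, j < i → U i j = 0) ∧ ∀ i, IsUnit (U i i)
  | 0, M, _ => ⟨1, M, by simp, fun i => i.elim0, fun i => i.elim0, fun i => i.elim0,
      fun i => i.elim0⟩
  | n + 1, M, hM => by
    have hf : ∀ i j, f (M i j) = if i = j then 1 else 0 := fun i j => by
      rw [← Matrix.map_apply (f := f), hM, Matrix.one_apply]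
    -- The pivot reduces to `1`, so it is a unit; its Schur complement `M'` again reduces to the
    -- identity.
    obtain ⟨m, hm⟩ : IsUnit (M 0 0) := isUnit_of_map_unit f _ (by simp [hf])
    let M' : Matrix (Fin n) (Fin n) R :=
      Matrix.of fun i j => M i.succ j.succ - M i.succ 0 * (m⁻¹ : Rˣ) * M 0 j.succ
    obtain ⟨L, U, hLU, hL, hL1, hU, hU1⟩ := exists_lower_mul_upper f n M' (by
      ext i j
      simp [M', hf, Matrix.one_apply])
    have hLU' : ∀ i j, ∑ k, L i k * U k j =
        M i.succ j.succ - M i.succ 0 * (m⁻¹ : Rˣ) * M 0 j.succ := fun i j => by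
      rw [← Matrix.mul_apply, ← hLU]; rfl
    refine ⟨Matrix.of fun i j => Fin.cases (Fin.cases 1 (fun _ => 0) j)
        (fun i' => Fin.cases (M i'.succ 0 * (m⁻¹ : Rˣ)) (fun j' => L i' j') j) i,
      Matrix.of fun i j => Fin.cases (M 0 j)
        (fun i' => Fin.cases 0 (fun j' => U i' j') j) i, ?_, ?_, ?_, ?_, ?_⟩
    · ext i j
      refine Fin.cases ?_ (fun i => ?_) i <;> refine Fin.cases ?_ (fun j => ?_) j <;>
        simp [Matrix.mul_apply, Fin.sum_univ_succ, hLU', ← hm]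
    · intro i j
      refine Fin.cases ?_ (fun i => ?_) i <;> refine Fin.cases ?_ (fun j => ?_) j <;>
        simp
      exact hL i j
    · intro i
      refine Fin.cases ?_ (fun i => ?_) i <;> simp [hL1]
    · intro i j
      refine Fin.cases ?_ (fun i => ?_) i <;> refine Fin.cases ?_ (fun j => ?_) j <;>
        simp
      exact hU i j
    · intro i
      refine Fin.cases ?_ (fun i => ?_) i <;> simp [hU1, ← hm]

variable {n : ℕ}

theorem diagGL_apply (t : Idx n → Rˣ) : (diagGL t).val = Matrix.diagonal fun a => (t a : R) := rfl

theorem exists_diagGL_mul_lower (b : GL (Idx n) R) (hb : ∀ i j, pos i < pos j → b.val i j = 0)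
    (hb' : ∀ i, IsUnit (b.val i i)) :
    ∃ (t : Idx n → Rˣ) (u : GL (Idx n) R), IsLowerUnipotent u ∧ b = diagGL t * u := by
  let t : Idx n → Rˣ := fun i => (hb' i).unit
  refine ⟨t, (diagGL t)⁻¹ * b, ?_, by simp⟩
  have h : (diagGL t)⁻¹ = diagGL t⁻¹ := by
    rw [inv_eq_iff_mul_eq_one]
    apply Units.ext
    simp [diagGL_apply]
  intro i j hij
  rw [h, Units.val_mul, diagGL_apply, Matrix.diagonal_mul]
  rcases hij.lt_or_eq with hij | hij
  · have : i ≠ j := fun h => by simp [h] at hij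
    rw [hb i j hij, mul_zero, if_neg this]
  · obtain rfl := pos.injective hij
    simp [t]

theorem isUnit_of_map_isUnit (f : R →+* R') [IsLocalHom f] {m : Type*} [Fintype m] [DecidableEq m]
    (M : Matrix m m R) (hM : IsUnit (M.map f)) : IsUnit M := by
  rw [Matrix.isUnit_iff_isUnit_det] at hM ⊢
  refine isUnit_of_map_unit f _ ?_
  rwa [RingHom.map_det]

theorem isUnit_wMat : IsUnit (wMat n R) := .of_mul_eq_one _ (wMat_mul_self n R)

/-- Along a local homomorphism, matrices reducing to the identity lie in `ξ⁻¹ H ξ T N⁻`. -/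
theorem exists_xi_factorization (f : R →+* R') [IsLocalHom f] (g : GL (Idx n) R)
    (hg : g.val.map f = 1) : ∃ (h₁ h₂ : GL (Fin n) R) (t : Idx n → Rˣ) (u : GL (Idx n) R),
      IsLowerUnipotent u ∧ xi n R * g = iota h₁ h₂ * xi n R * diagGL t * u := by
  obtain ⟨a, b, c, d, habcd⟩ : ∃ a b c d, g.val = Matrix.fromBlocks a b c d :=
    ⟨_, _, _, _, (Matrix.fromBlocks_toBlocks _).symm⟩
  let W := wMat n R
  have hWW : W * W = 1 := wMat_mul_self n R
  rw [habcd, Matrix.fromBlocks_map, ← Matrix.fromBlocks_one, Matrix.fromBlocks_inj] at hg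
  obtain ⟨ha, hb, hc, hd⟩ := hg
  obtain ⟨d', hd'⟩ := isUnit_of_map_isUnit f d (by rw [hd]; exact isUnit_one)
  have he : (b + W * d).map f = wMat n R' := by
    rw [Matrix.map_add _ (map_add f), Matrix.map_mul, hb, hd, map_wMat, zero_add, mul_one]
  obtain ⟨e, he'⟩ := isUnit_of_map_isUnit f (b + W * d) (by rw [he]; exact isUnit_wMat)
  let s := a - b * d'⁻¹.val * c
  have hs : s.map f = 1 := by
    rw [Matrix.map_sub _ (map_sub f), Matrix.map_mul, Matrix.map_mul, hb, ha]
    simp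
  have hM : (e⁻¹.val * s * W).map f = 1 := by
    rw [Matrix.map_mul, Matrix.map_mul, hs, mul_one, map_wMat]
    have h1 : e⁻¹.val.map f * wMat n R' = 1 := by
      rw [← he, ← he', ← Matrix.map_mul, Units.inv_mul, Matrix.map_one _ (map_zero f) (map_one f)]
    exact h1
  -- Seek `ξ g = ι(h₁, h₂) ξ β₀` with `β₀` lower triangular and lower right block `l⁻¹`. The second
  -- block column forces `h₁ = e l w_n` and `h₂ = w_n d l w_n`. The upper left block is then `w_n U
  -- w_n` with `l U = e⁻¹ s w_n`; it is lower triangular exactly when `U` is upper triangular.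
  obtain ⟨L, U, hLU, hL, hL1, hU, hU1⟩ := exists_lower_mul_upper f n _ hM
  have hLb : L.BlockTriangular OrderDual.toDual := fun i j hij => hL i j hij
  obtain ⟨l, rfl⟩ : IsUnit L := by
    rw [Matrix.isUnit_iff_isUnit_det, Matrix.det_of_isLowerTriangular _ hLb]
    simp [hL1]
  have hq : (l⁻¹).val.BlockTriangular OrderDual.toDual := by
    have := l.invertible
    rw [Matrix.coe_units_inv]
    exact Matrix.blockTriangular_inv_of_blockTriangular hLb
  have hq1 : ∀ i, IsUnit (l⁻¹.val i i) := by
    intro i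
    have h1 : IsUnit (l⁻¹.val.det) := (Matrix.isUnit_iff_isUnit_det _).mp (l⁻¹).isUnit
    rw [Matrix.det_of_isLowerTriangular _ hq] at h1
    exact isUnit_of_dvd_unit (Finset.dvd_prod_of_mem (fun i => l⁻¹.val i i)
      (Finset.mem_univ i)) h1
  let ω : GL (Fin n) R := ⟨W, W, hWW, hWW⟩
  let h₁ : GL (Fin n) R := e * l * ω
  let h₂ : GL (Fin n) R := ω * d' * l * ω
  let β₀ : Matrix (Idx n) (Idx n) R :=
    Matrix.fromBlocks (W * U * W) 0 (l⁻¹.val * d'⁻¹.val * c) l⁻¹.val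
  have hmat : (xi n R * g).val = (iota h₁ h₂ * xi n R).val * β₀ := by
    have hd1 : d * d'⁻¹.val = 1 := by rw [← hd', Units.mul_inv]
    have hl1 : l.val * l⁻¹.val = 1 := Units.mul_inv _
    have i1 : e.val * l.val * W * (W * U * W) = s := by
      calc e.val * l.val * W * (W * U * W) = e.val * (l.val * ((W * W) * U) * W) := by
            simp only [mul_assoc]
        _ = (e.val * e⁻¹.val) * s * (W * W) := by 
            rw [hWW, one_mul, ← hLU, mul_one]; simp only [mul_assoc, hWW, mul_one]
        _ = s := by rw [hWW, Units.mul_inv, one_mul, mul_one]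
    have i2 : e.val * l.val * W * W * (l⁻¹.val * d'⁻¹.val * c) = b * d'⁻¹.val * c + W * c := by
      calc e.val * l.val * W * W * (l⁻¹.val * d'⁻¹.val * c)
          = e.val * l.val * (W * W) * (l⁻¹.val * d'⁻¹.val * c) := by simp only [mul_assoc]
        _ = e.val * (l.val * l⁻¹.val) * d'⁻¹.val * c := by
            rw [hWW, mul_one]; simp only [mul_assoc]
        _ = b * d'⁻¹.val * c + W * (d * d'⁻¹.val) * c := by
            rw [hl1, he', mul_one, add_mul, add_mul]; simp only [mul_assoc]
        _ = _ := by rw [hd1, mul_one]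
    have i3 : e.val * l.val * W * W * l⁻¹.val = b + W * d := by
      rw [mul_assoc _ W W, hWW, mul_one, mul_assoc, hl1, mul_one, he']
    have i4 : W * d'.val * l.val * W * W * (l⁻¹.val * d'⁻¹.val * c) = W * c := by
      calc W * d'.val * l.val * W * W * (l⁻¹.val * d'⁻¹.val * c)
          = W * d'.val * l.val * (W * W) * (l⁻¹.val * d'⁻¹.val * c) := by simp only [mul_assoc]
        _ = W * d'.val * (l.val * l⁻¹.val) * d'⁻¹.val * c := by
            rw [hWW, mul_one]; simp only [mul_assoc]
        _ = W * (d * d'⁻¹.val) * c := by rw [hl1, mul_one, hd']; simp only [mul_assoc]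
        _ = _ := by rw [hd1, mul_one]
    have i5 : W * d'.val * l.val * W * W * l⁻¹.val = W * d := by
      rw [mul_assoc _ W W, hWW, mul_one, mul_assoc, hl1, mul_one, hd']
    change Matrix.fromBlocks 1 W 0 W * g.val = Matrix.fromBlocks (e.val * l.val * W) 0 0
      (W * d'.val * l.val * W) * Matrix.fromBlocks 1 W 0 W * β₀
    rw [habcd, Matrix.fromBlocks_multiply, Matrix.fromBlocks_multiply, Matrix.fromBlocks_multiply]
    simp only [zero_mul, mul_zero, mul_one, one_mul, zero_add, add_zero, i1, i2, i3, i4, i5, s]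
    congr 1
    abel
  have hβ : ((iota h₁ h₂ * xi n R)⁻¹ * (xi n R * g)).val = β₀ := by
    rw [Units.val_mul, hmat, ← mul_assoc, Units.inv_mul, one_mul]
  obtain ⟨t, u, hu, htu⟩ := exists_diagGL_mul_lower ((iota h₁ h₂ * xi n R)⁻¹ * (xi n R * g)) (by
    rw [hβ]
    rintro (i | i) (j | j) hij
    · have hij : i < j := hij
      simp [β₀, W, wMat_mul_apply, mul_wMat_apply, hU _ _ (Fin.rev_lt_rev.mpr hij)]
    · rfl
    · simp [Fin.lt_def] at hij
      omega
    · have hij : i < j := by simpa using hij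
      exact hq hij) (by
    rw [hβ]
    rintro (i | i)
    · simpa [β₀, W, wMat_mul_apply, mul_wMat_apply] using hU1 _
    · exact hq1 i)
  refine ⟨h₁, h₂, t, u, hu, ?_⟩
  rw [mul_assoc (iota h₁ h₂ * xi n R), ← htu, mul_inv_cancel_left]

end Factorization

/-! ### The universal point of `G` and its formal expansion at the identity -/

section Generic

/-- The function `N_{F/ℚ} ∘ det`. -/
def normDet {F : Type v} [Field F] {n : ℕ} {A : Type u} [CommRing A]
    (M : Matrix (Idx n) (Idx n) (RO F A)) : A :=
  Algebra.norm A M.det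

theorem normDet_one {F : Type v} [Field F] {n : ℕ} {A : Type u} [CommRing A] :
    normDet (1 : Matrix (Idx n) (Idx n) (RO F A)) = 1 := by
  rw [normDet, Matrix.det_one, map_one]

variable {F : Type v} [Field F] [NumberField F] {n : ℕ} {E : Type u} [Field E]

/-- Units of `A ⊗ 𝓞_F` are detected by the norm, which commutes with base change. -/
theorem RO.isLocalHom_map {A B : Type u} [CommRing A] [CommRing B] (f : A →+* B)
    [IsLocalHom f] : IsLocalHom (RO.map F f) where
  map_nonunit x hx := by
    refine isUnit_of_isUnit_norm x (isUnit_of_map_unit f _ ?_)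
    rw [← RO.norm_map]
    exact hx.map _

variable (F n) in
/-- The coordinates of the generic matrix. -/
abbrev Coord : Type := Idx n × Idx n × Fin (Module.finrank ℤ (𝓞 F))

variable (F n) in
/-- The matrix `1 + ∑ s_{a,b,k} ω_k` with coordinates `s`. -/
def coordMatrix {A : Type u} [CommRing A] (s : Coord F n → A) :
    Matrix (Idx n) (Idx n) (RO F A) :=
  1 + Matrix.of fun a b => ∑ k, s (a, b, k) • roBasis F A k

theorem coordMatrix_map {A B : Type u} [CommRing A] [CommRing B] (f : A →+* B)
    (s : Coord F n → A) : (coordMatrix F n s).map (RO.map F f) = coordMatrix F n (f ∘ s) := by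
  have h : ∀ (a : A) (x : RO F A), RO.map F f (a • x) = f a • RO.map F f x := by
    intro a x
    induction x using TensorProduct.induction_on with
    | zero => simp
    | add x y hx hy => simp [hx, hy]
    | tmul b x => simp [TensorProduct.smul_tmul']
  ext a b
  by_cases hab : a = b <;> simp [coordMatrix, hab, map_sum, h, RO.map_roBasis]

theorem coordMatrix_zero {A : Type u} [CommRing A] :
    coordMatrix F n (fun _ => (0 : A)) = 1 := by
  ext a b
  simp [coordMatrix]

theorem exists_coordMatrix {A : Type u} [CommRing A] (M : Matrix (Idx n) (Idx n) (RO F A)) :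
    ∃ s, coordMatrix F n s = M := by
  refine ⟨fun c => (roBasis F A).repr ((M - 1) c.1 c.2.1) c.2.2, ?_⟩
  ext a b
  simp only [coordMatrix, Matrix.add_apply, Matrix.of_apply, Module.Basis.sum_repr]
  simp

theorem isUnit_iff_normDet {A : Type u} [CommRing A] (M : Matrix (Idx n) (Idx n) (RO F A)) :
    IsUnit M ↔ IsUnit (normDet M) := by
  rw [normDet, Matrix.isUnit_iff_isUnit_det]
  exact ⟨fun h => h.map _, isUnit_of_isUnit_norm _⟩

theorem map_normDet {A B : Type u} [CommRing A] [CommRing B] (f : A →+* B)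
    (M : Matrix (Idx n) (Idx n) (RO F A)) :
    f (normDet M) = normDet (M.map (RO.map F f)) := by
  rw [normDet, normDet, ← RO.norm_map, RingHom.map_det]
  rfl

variable (F n E) in
/-- The generic matrix over the polynomial ring in its coordinates. -/
def genericMatrix : Matrix (Idx n) (Idx n) (RO F (MvPolynomial (Coord F n) E)) :=
  coordMatrix F n MvPolynomial.X

section UnivPoint

variable (S : Type u) [CommRing S] [Algebra (MvPolynomial (Coord F n) E) S]
  [IsLocalization.Away (normDet (genericMatrix F n E)) S]

variable (F n E) in
theorem isUnit_genericMatrix_map : IsUnit ((genericMatrix F n E).map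
    (RO.map F (algebraMap (MvPolynomial (Coord F n) E) S))) := by
  rw [isUnit_iff_normDet, ← map_normDet]
  exact IsLocalization.Away.algebraMap_isUnit _

variable (F n E) in
/-- The universal point of `G`, over its coordinate ring. -/
def univPoint : GPts F n S := (isUnit_genericMatrix_map F n E S).unit

theorem map_univPoint_val {B : Type u} [CommRing B] (f : S →+* B) :
    (univPoint F n E S).val.map (RO.map F f) =
      (genericMatrix F n E).map (RO.map F (f.comp (algebraMap _ S))) := by
  change ((genericMatrix F n E).map (RO.map F (algebraMap _ S))).map (RO.map F f) = _
  ext a b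
  simp only [Matrix.map_apply, RO.map_map]

variable [Algebra E S] [IsScalarTower E (MvPolynomial (Coord F n) E) S]

theorem exists_map_univPoint {B : Type u} [CommRing B] [Algebra E B] (g : GPts F n B) :
    ∃ f : S →ₐ[E] B, Matrix.GeneralLinearGroup.map (RO.map F (f : S →+* B))
      (univPoint F n E S) = g := by
  obtain ⟨s, hs⟩ := exists_coordMatrix g.val
  let φ : MvPolynomial (Coord F n) E →ₐ[E] B := MvPolynomial.aeval s
  have hφ : (genericMatrix F n E).map (RO.map F
      (φ : MvPolynomial (Coord F n) E →+* B)) = g.val := by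
    rw [genericMatrix, coordMatrix_map, ← hs]
    congr 1
    ext c
    simp [φ]
  have hu : IsUnit (φ (normDet (genericMatrix F n E))) := by
    have := map_normDet (φ : MvPolynomial (Coord F n) E →+* B) (genericMatrix F n E)
    rw [hφ] at this
    change IsUnit ((φ : MvPolynomial (Coord F n) E →+* B) _)
    rw [this, ← isUnit_iff_normDet]
    exact g.isUnit
  let f : S →ₐ[E] B := IsLocalization.Away.liftAlgHom (normDet (genericMatrix F n E)) hu
  refine ⟨f, Units.ext ?_⟩
  have hf : (f : S →+* B).comp (algebraMap _ S) =
      (φ : MvPolynomial (Coord F n) E →+* B) := by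
    ext x <;> simp [f]
  change (univPoint F n E S).val.map (RO.map F (f : S →+* B)) = g.val
  rw [map_univPoint_val, hf, hφ]

/-- The coordinates are centred at the identity, so the determinant norm has constant term `1` and
becomes invertible in power series. Injectivity makes vanishing on the formal neighbourhood imply
vanishing everywhere. -/
theorem exists_univPoint_powerSeries (K : Type u) [Field K] [Algebra E K] :
    ∃ f : S →ₐ[E] MvPowerSeries (Coord F n) K, Function.Injective f ∧
      (univPoint F n E S).val.map (RO.map F
        (MvPowerSeries.constantCoeff.comp (f : S →+* MvPowerSeries (Coord F n) K))) = 1 := by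
  let φ : MvPolynomial (Coord F n) E →ₐ[E] MvPowerSeries (Coord F n) K :=
    MvPolynomial.coeToMvPowerSeries.algHom K
  have hφ : Function.Injective φ := by
    intro x y hxy
    ext m
    have := congrArg (MvPowerSeries.coeff m) hxy
    simpa [φ] using this
  have h1 : (genericMatrix F n E).map (RO.map F ((MvPowerSeries.constantCoeff).comp
      (φ : MvPolynomial (Coord F n) E →+* MvPowerSeries (Coord F n) K))) = 1 := by
    rw [genericMatrix, coordMatrix_map, ← coordMatrix_zero]
    congr 1
    ext c
    simp [φ]
  have hu : IsUnit (φ (normDet (genericMatrix F n E))) := by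
    rw [MvPowerSeries.isUnit_iff_constantCoeff]
    have := map_normDet ((MvPowerSeries.constantCoeff).comp
      (φ : MvPolynomial (Coord F n) E →+* MvPowerSeries (Coord F n) K)) (genericMatrix F n E)
    rw [h1, normDet_one] at this
    exact this.symm ▸ isUnit_one
  let f : S →ₐ[E] MvPowerSeries (Coord F n) K :=
    IsLocalization.Away.liftAlgHom (normDet (genericMatrix F n E)) hu
  have hf : ∀ x, (f : S →+* MvPowerSeries (Coord F n) K) (algebraMap _ S x) = φ x := fun x => by
    simp [f]
  refine ⟨f, ?_, ?_⟩
  · refine (IsLocalization.injective_iff_map_algebraMap_eq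
      (Submonoid.powers (normDet (genericMatrix F n E)))
      (f : S →+* MvPowerSeries (Coord F n) K)).mpr fun x y => ?_
    rw [hf, hf]
    refine ⟨fun h => ?_, fun h => by rw [hφ h]⟩
    rw [← hf, ← hf, h]
  · rw [← h1, map_univPoint_val, RingHom.comp_assoc]
    congr 4
    exact RingHom.ext hf

end UnivPoint

end Generic

/-! ### Matrix coefficients and the non-vanishing of `κ(ξ v₀)` -/

namespace AlgRep

variable {F : Type v} [Field F] {n : ℕ} {E : Type u} [Field E]
  {V : Type w} [AddCommGroup V] [Module E V] (ρ : AlgRep F n E V)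

/-- The matrix coefficient `x ↦ κ(g x)` at a point `g` of `G(A)`. -/
def matCoeff (κ : V →ₗ[E] E) {A : Type u} [CommRing A] [Algebra E A] (g : GPts F n A) :
    V →ₗ[E] A :=
  (TensorProduct.rid E A).toLinearMap ∘ₗ κ.lTensor A ∘ₗ (ρ.act A g).restrictScalars E ∘ₗ
    TensorProduct.mk E A V 1

theorem matCoeff_apply (κ : V →ₗ[E] E) {A : Type u} [CommRing A] [Algebra E A] (g : GPts F n A)
    (x : V) : ρ.matCoeff κ g x = TensorProduct.rid E A (κ.lTensor A (ρ.act A g (1 ⊗ₜ x))) := rfl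

theorem matCoeff_map (κ : V →ₗ[E] E) {A B : Type u} [CommRing A] [Algebra E A] [CommRing B]
    [Algebra E B] (f : A →ₐ[E] B) (g : GPts F n A) (x : V) :
    ρ.matCoeff κ (Matrix.GeneralLinearGroup.map (RO.map F (f : A →+* B)) g) x =
      f (ρ.matCoeff κ g x) := by
  have h := ρ.natural A B f g (1 ⊗ₜ x)
  rw [LinearMap.rTensor_tmul, AlgHom.toLinearMap_apply, map_one] at h
  rw [matCoeff_apply, matCoeff_apply, ← h]
  generalize ρ.act A g (1 ⊗ₜ x) = y
  induction y with
  | zero => simp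
  | add y z hy hz => simp only [map_add, hy, hz]
  | tmul a y => simp

/-- The vectors all of whose matrix coefficients against `κ` vanish. -/
def coeffKer (κ : V →ₗ[E] E) : Submodule E V where
  carrier := {x | ∀ (A : Type u) [CommRing A] [Algebra E A] (g : GPts F n A),
    ρ.matCoeff κ g x = 0}
  zero_mem' _ _ _ _ := map_zero _
  add_mem' hx hy A _ _ g := by rw [map_add, hx A g, hy A g, add_zero]
  smul_mem' c x hx A _ _ g := by rw [map_smul, hx A g, smul_zero]

theorem rid_lTensor_smul (κ : V →ₗ[E] E) {A : Type u} [CommRing A] [Algebra E A] (c : A)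
    (y : A ⊗[E] V) : TensorProduct.rid E A (κ.lTensor A (c • y)) =
      c * TensorProduct.rid E A (κ.lTensor A y) := by
  induction y with
  | zero => simp
  | add y z hy hz => simp only [smul_add, map_add, mul_add, hy, hz]
  | tmul a y => simp [TensorProduct.smul_tmul']

theorem productMap_lTensor_matCoeff (κ : V →ₗ[E] E) {A B C : Type u} [CommRing A] [Algebra E A]
    [CommRing B] [Algebra E B] [CommRing C] [Algebra E C] (i₁ : A →ₐ[E] C) (i₂ : B →ₐ[E] C)
    (h : GPts F n B) (y : A ⊗[E] V) :
    Algebra.TensorProduct.productMap i₁ i₂ ((ρ.matCoeff κ h).lTensor A y) =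
      TensorProduct.rid E C (κ.lTensor C (ρ.act C
        (Matrix.GeneralLinearGroup.map (RO.map F (i₂ : B →+* C)) h)
          (i₁.toLinearMap.rTensor V y))) := by
  induction y with
  | zero => simp
  | add y z hy hz => simp only [map_add, hy, hz]
  | tmul a y =>
    rw [LinearMap.rTensor_tmul, act_tmul, LinearMap.lTensor_tmul, rid_lTensor_smul,
      ← matCoeff_apply, matCoeff_map]
    simp

theorem productMap_lTensor_matCoeff_act (κ : V →ₗ[E] E) {x : V} (hx : x ∈ ρ.coeffKer κ)
    {A B C : Type u} [CommRing A] [Algebra E A] [CommRing B] [Algebra E B] [CommRing C]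
    [Algebra E C] (i₁ : A →ₐ[E] C) (i₂ : B →ₐ[E] C) (g : GPts F n A) (h : GPts F n B) :
    Algebra.TensorProduct.productMap i₁ i₂
      ((ρ.matCoeff κ h).lTensor A (ρ.act A g (1 ⊗ₜ x))) = 0 := by
  rw [productMap_lTensor_matCoeff, ρ.natural A C i₁ g, LinearMap.rTensor_tmul,
    AlgHom.toLinearMap_apply, map_one, ← Module.End.mul_apply, ← map_mul]
  exact hx _ _

/-- Both points are compared over `A ⊗ B`, where `κ(h g x)` vanishes because `h g` is again a point
of `G`. -/
theorem lTensor_matCoeff_act (κ : V →ₗ[E] E) {x : V} (hx : x ∈ ρ.coeffKer κ) {A B : Type u}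
    [CommRing A] [Algebra E A] [CommRing B] [Algebra E B] (g : GPts F n A) (h : GPts F n B) :
    (ρ.matCoeff κ h).lTensor A (ρ.act A g (1 ⊗ₜ x)) = 0 := by
  have h1 := ρ.productMap_lTensor_matCoeff_act κ hx
    (Algebra.TensorProduct.includeLeft : A →ₐ[E] A ⊗[E] B)
    (Algebra.TensorProduct.includeRight : B →ₐ[E] A ⊗[E] B) g h
  have h2 : Algebra.TensorProduct.productMap
      (Algebra.TensorProduct.includeLeft : A →ₐ[E] A ⊗[E] B)
      (Algebra.TensorProduct.includeRight : B →ₐ[E] A ⊗[E] B) = AlgHom.id E (A ⊗[E] B) := by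
    ext <;> simp
  rwa [h2] at h1

/-- Expand `g x` along an `E`-basis of `A`: by `lTensor_matCoeff_act`, each coordinate vector has
all matrix coefficients zero. -/
theorem act_mem_baseChange_coeffKer (κ : V →ₗ[E] E) {x : V} (hx : x ∈ ρ.coeffKer κ) {A : Type u}
    [CommRing A] [Algebra E A] (g : GPts F n A) :
    ρ.act A g (1 ⊗ₜ x) ∈ (ρ.coeffKer κ).baseChange A := by
  let b := Module.Basis.ofVectorSpace E A
  obtain ⟨c, hc⟩ := TensorProduct.eq_repr_basis_left b (ρ.act A g (1 ⊗ₜ x))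
  rw [← hc]
  refine Submodule.sum_mem _ fun i _ => ?_
  have hi : c i ∈ ρ.coeffKer κ := by
    intro B _ _ h
    have h1 := ρ.lTensor_matCoeff_act κ hx g h
    rw [← hc] at h1
    have h2 := congrArg (contract B (b.coord i)) h1
    have h3 : c i ≠ 0 → ρ.matCoeff κ h (c i) = 0 := by
      classical
      simpa [Finsupp.sum, Finsupp.single_apply] using h2
    by_cases hci : c i = 0
    · rw [hci, map_zero]
    · exact h3 hci
  exact Submodule.tmul_mem_baseChange_of_mem (b i) hi

theorem coeffKer_eq_bot (hρ : ρ.IsIrreducible) {κ : V →ₗ[E] E} (hκ : κ ≠ 0) :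
    ρ.coeffKer κ = ⊥ := by
  refine (hρ.2 (ρ.coeffKer κ) fun A _ _ g x hx =>
    ρ.act_mem_baseChange_coeffKer κ hx g).resolve_right fun h => hκ ?_
  ext x
  have h1 : x ∈ ρ.coeffKer κ := h ▸ Submodule.mem_top
  simpa [matCoeff_apply] using h1 E 1

theorem map_xi_unit {R S : Type*} [CommRing R] [CommRing S] (f : R →+* S) :
    Matrix.GeneralLinearGroup.map f (xi n R) = xi n S :=
  Units.ext (map_xi f)

variable [NumberField F] [CharZero E]

theorem matCoeff_xi_mul_eq_zero {μ : Weight F E n} {v₀ : V} (hv₀ : ρ.IsLowestWeightVector μ v₀)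
    {j₁ j₂ : ℤ} {κ : V →ₗ[E] E} (hκ : ρ.IsHEquivariant j₁ j₂ κ)
    (h0 : κ (ρ.onPts (xi n (RO F E)) v₀) = 0) {A : Type u} [CommRing A] [Algebra E A]
    [Algebra (AlgebraicClosure E) A] [IsScalarTower E (AlgebraicClosure E) A]
    (h₁ h₂ : GL (Fin n) (RO F A)) (t : Idx n → (RO F A)ˣ) (u : GPts F n A)
    (hu : IsLowerUnipotent u) :
    ρ.matCoeff κ (iota h₁ h₂ * xi n (RO F A) * diagGL t * u) v₀ = 0 := by
  have h1 : κ.lTensor A (ρ.act A (iota h₁ h₂) (1 ⊗ₜ ρ.onPts (xi n (RO F E)) v₀)) = 0 := by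
    have := hκ A h₁ h₂ (ρ.onPts (xi n (RO F E)) v₀)
    rw [h0, TensorProduct.tmul_zero] at this
    exact this
  rw [matCoeff_apply, map_mul, map_mul, map_mul, Module.End.mul_apply, hv₀.2.2 A u hu,
    Module.End.mul_apply, hv₀.2.1 A t, Module.End.mul_apply, act_tmul,
    ← map_xi_unit (RO.map F (algebraMap E A)), act_map_one_tmul]
  rw [map_smul, rid_lTensor_smul, h1, map_zero, mul_zero]

theorem map_matCoeff_xi_mul_eq_zero {μ : Weight F E n} {v₀ : V}
    (hv₀ : ρ.IsLowestWeightVector μ v₀) {j₁ j₂ : ℤ} {κ : V →ₗ[E] E}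
    (hκ : ρ.IsHEquivariant j₁ j₂ κ) (h0 : κ (ρ.onPts (xi n (RO F E)) v₀) = 0)
    {S A B : Type u} [CommRing S] [Algebra E S] [CommRing A] [Algebra E A] [CommRing B]
    [Algebra (AlgebraicClosure E) A] [IsScalarTower E (AlgebraicClosure E) A]
    (f : S →ₐ[E] A) (c : A →+* B) [IsLocalHom c] (g : GPts F n S)
    (hg : g.val.map (RO.map F (c.comp (f : S →+* A))) = 1) :
    f (ρ.matCoeff κ (xi n (RO F S) * g) v₀) = 0 := by
  have := RO.isLocalHom_map (F := F) c
  obtain ⟨h₁, h₂, t, u, hu, h⟩ := exists_xi_factorization (RO.map F c)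
    (Matrix.GeneralLinearGroup.map (RO.map F (f : S →+* A)) g) (by
      rw [← hg]
      ext a b
      exact RO.map_map _ _ _)
  rw [← matCoeff_map, map_mul, map_xi_unit, h]
  exact ρ.matCoeff_xi_mul_eq_zero hv₀ hκ h0 h₁ h₂ t u hu

/-- The coefficient of `v₀` at `ξ` times the universal point vanishes after expansion in power
series, hence vanishes. Every point of `G` is a specialization of this product. -/
theorem mem_coeffKer {μ : Weight F E n} {v₀ : V} (hv₀ : ρ.IsLowestWeightVector μ v₀)
    {j₁ j₂ : ℤ} {κ : V →ₗ[E] E} (hκ : ρ.IsHEquivariant j₁ j₂ κ)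
    (h0 : κ (ρ.onPts (xi n (RO F E)) v₀) = 0)
    (S : Type u) [CommRing S] [Algebra (MvPolynomial (Coord F n) E) S]
    [IsLocalization.Away (normDet (genericMatrix F n E)) S]
    [Algebra E S] [IsScalarTower E (MvPolynomial (Coord F n) E) S] :
    v₀ ∈ ρ.coeffKer κ := by
  obtain ⟨f, hf, hf1⟩ := exists_univPoint_powerSeries (F := F) (n := n) (E := E) S
    (AlgebraicClosure E)
  have hloc : IsLocalHom (MvPowerSeries.constantCoeff :
      MvPowerSeries (Coord F n) (AlgebraicClosure E) →+* AlgebraicClosure E) :=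
    ⟨fun _ h => MvPowerSeries.isUnit_iff_constantCoeff.mpr h⟩
  have hS : ρ.matCoeff κ (xi n (RO F S) * univPoint F n E S) v₀ = 0 := by
    apply hf
    rw [map_zero]
    exact ρ.map_matCoeff_xi_mul_eq_zero hv₀ hκ h0 f MvPowerSeries.constantCoeff _ hf1
  intro A _ _ g
  obtain ⟨k, hk⟩ := exists_map_univPoint (E := E) S ((xi n (RO F A))⁻¹ * g)
  have h1 := ρ.matCoeff_map κ k (xi n (RO F S) * univPoint F n E S) v₀
  rwa [hS, map_zero, map_mul, hk, map_xi_unit, mul_inv_cancel_left] at h1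

theorem apply_xi_ne_zero (hρ : ρ.IsIrreducible) {μ : Weight F E n} {v₀ : V}
    (hv₀ : ρ.IsLowestWeightVector μ v₀) {j₁ j₂ : ℤ} {κ : V →ₗ[E] E} (hκ0 : κ ≠ 0)
    (hκ : ρ.IsHEquivariant j₁ j₂ κ) : κ (ρ.onPts (xi n (RO F E)) v₀) ≠ 0 := by
  intro h0
  have hmem := ρ.mem_coeffKer hv₀ hκ h0 (Localization.Away (normDet (genericMatrix F n E)))
  rw [ρ.coeffKer_eq_bot hρ hκ0] at hmem
  exact hv₀.1 hmem

end AlgRep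

end

theorem proposition2p5 (p : ℕ) [Fact p.Prime]
    (F : Type v) [Field F] [NumberField F] [NumberField.IsTotallyReal F]
    (E : Type u) [Field E] [CharZero E] [Algebra ℚ_[p] E] [FiniteDimensional ℚ_[p] E]
    (n : ℕ) (hn : 0 < n)
    (μ : Weight F E n) (hdom : IsDominant μ) (w₀ : ℤ) (hpure : IsPure μ w₀)
    (hdef : IsDefinedOver μ)
    (V : Type w) [AddCommGroup V] [Module E V] [FiniteDimensional E V]
    (ρ : AlgRep F n E V) (hρ : ρ.IsModel μ)
    (v₀ : V) (hv₀ : ρ.IsLowestWeightVector μ v₀)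
    (κ : ℤ → V →ₗ[E] E)
    (hκ : ∀ j ∈ Crit μ, κ j ≠ 0 ∧ ρ.IsHEquivariant j (w₀ - j) (κ j)) :
    -- the normalization is possible, and the normalized functionals are integral on `ξ V_O`
    (∀ j ∈ Crit μ, κ j (ρ.onPts (xi n (RO F E)) v₀) ≠ 0 ∧
      ∀ x ∈ ρ.lattice (ringInt p E) v₀,
        ρ.normalized (κ j) v₀ (ρ.onPts (xi n (RO F E)) x) ∈ ringInt p E) ∧
    -- `(ξ t_p^β) • V_O ⊆ ξ V_O`, and the congruence modulo `p^β` on `(ξ t_p^β) • V_O`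
    ∀ β : ℕ, ∀ v ∈ ρ.bullet p μ β '' ρ.lattice (ringInt p E) v₀,
      v ∈ ρ.onPts (xi n (RO F E)) '' ρ.lattice (ringInt p E) v₀ ∧
      ∀ j ∈ Crit μ, ∀ j' ∈ Crit μ,
        ∃ c ∈ ringInt p E,
          ρ.normalized (κ j) v₀ v - ρ.normalized (κ j') v₀ v = (p : E) ^ β * c := by
  have h0 : ∀ j ∈ Crit μ, κ j (ρ.onPts (xi n (RO F E)) v₀) ≠ 0 := fun j hj =>
    ρ.apply_xi_ne_zero hρ.1 hv₀ (hκ j hj).1 (hκ j hj).2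
  have hcong : ∀ j ∈ Crit μ, ∀ j' ∈ Crit μ, ∀ β : ℕ, ∀ T ∈ Algebra.adjoin (ringInt p E)
      (ρ.parahoricOps p (ringInt p E) β), T v₀ ∈ congruenceSubmodule (ringInt p E) ((p : E) ^ β)
        (ρ.normalizedXi (κ j) v₀) (ρ.normalizedXi (κ j') v₀) := fun j hj j' hj' β T hT =>
    ρ.mem_congruenceSubmodule_of_mem_adjoin p (ringInt p E) (hv₀.exists_lie_lower ρ p)
      (hκ j hj).2 (hκ j' hj').2 (h0 j hj) (h0 j' hj') β hT
  refine ⟨fun j hj => ⟨h0 j hj, ?_⟩, fun β => ?_⟩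
  · rintro _ ⟨T, hT, rfl⟩
    -- Integrality is the case `β = 0`, `j' = j`, in which the block condition is empty.
    have h := (hcong j hj j hj 0 T (ρ.envN_le_adjoin_parahoricOps p _ hT)).1
    rwa [AlgRep.normalizedXi_apply] at h
  · rintro _ ⟨_, ⟨T, hT, rfl⟩, rfl⟩
    obtain ⟨T', hT', hT'', hconj⟩ := ρ.exists_conj_tp_pow p (ringInt p E) β hT
    rw [ρ.bullet_apply p hv₀ hconj]
    refine ⟨⟨T' v₀, ⟨T', hT', rfl⟩, rfl⟩, fun j hj j' hj' => ?_⟩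
    have h := (hcong j hj j' hj' β T' hT'').2.2
    rwa [AlgRep.normalizedXi_apply, AlgRep.normalizedXi_apply] at h
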